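/- A (finite) pre-semifield is a finite abelian group $(S,+)$ with a biadditive multiplication $\circ$ without zero divisors; it is a semifield if $\circ$ has a two-sided identity. Two pre-semifields are isotopic if $N_1(x\circ_1 y)=N_2(x)\circ_2N_3(y)$ for additive bijections $N_1,N_2,N_3$. The dual $\pi_1(S)$ has multiplication $(x,y)\mapsto y\circ x$; the transpose $\pi_2(S)$ has the multiplication $\circ^t$ with $B(a\circ^t y,x)=B(a,x\circ y)$ for a nondegenerate symmetric $\mathbb F_p$-bilinear form $B$ on $S$ (it is the pre-semifield belonging to the dual spread, and is unique up to isotopy). $S_1$ is equivalent to $S_2$ if $S_1$ is isotopic to a member of the Knuth orbit $\{S_2,\pi_1S_2,\pi_2S_2,\pi_2\pi_1S_2,\pi_1\pi_2S_2,\pi_1\pi_2\pi_1S_2\}$. Let $L=\mathbb F_{p^m}$, let $\sigma,\tau$ be automorphisms of $L$ with $\tau\ne\mathrm{id}$, $\sigma^2\neq\mathrm{id}$, let $K$ be the fixed field of $\sigma$, and let $\alpha,\eta\in L$ with $\alpha\notin L^{\sigma+1}(L^{*})^{\tau-1}$ (in particular $\alpha\ne0$) and $N_{L:K}(\eta)\neq1$.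 Let $\mathcal S_{\sigma,\tau,\alpha,\eta}$ be $L^2$ with the multiplication $$\begin{pmatrix}x_0\\x_1\end{pmatrix}\circ\begin{pmatrix}y_0\\y_1\end{pmatrix}=\begin{pmatrix}x_1y_1^\sigma-\eta x_1^\sigma y_1+\alpha\,(x_0y_0^\sigma-\eta^{\tau^{-1}}x_0^\sigma y_0)\\ x_0^\tau y_1+x_1y_0^\tau\end{pmatrix}.$$ The known semifields of order $p^{2m}$ are understood to be the following, in each case with all parameters for which the product is a pre-semifield (and with $\overline\sigma=\sigma^{-1}$, all Greek letters as exponents being automorphisms of $L$ unless stated otherwise): 1. all commutative pre-semifields (among them finite fields and the commutative semifields of Ganley, Cohen–Ganley, Kantor, Budaghyan–Helleseth, Zha–Kyureghyan–Wang, Bierbrauer); 2. all semifields one of whose left, middle and right nuclei has at least $p^m$ elements; 3. generalized Dickson: $(x_0y_0+\alpha x_1^\rho y_1^\tau,\ x_0^\sigma y_1+x_1y_0)$; 4. Knuth I–IV: $(x_0y_0+\alpha x_1^{\sigma}y_1^{\overline\sigma^2},\ x_1y_0+x_0^\sigma y_1+\beta x_1^\sigma y_1^{\overline\sigma})$, $(x_0y_0+\alpha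 x_1^{\sigma}y_1,\ x_1y_0+x_0^\sigma y_1+\beta x_1^\sigma y_1)$, $(x_0y_0+\alpha x_1^{\overline\sigma}y_1^{\overline\sigma^2},\ x_1y_0+x_0^\sigma y_1+\beta x_1 y_1^{\overline\sigma})$, $(x_0y_0+\alpha x_1^{\overline\sigma}y_1,\ x_1y_0+x_0^\sigma y_1+\beta x_1y_1)$; 5. Bierbrauer: $(\delta x_1y_1^\sigma+\gamma x_0y_1^\sigma+\beta x_1y_0^\sigma+\alpha x_0y_0^\sigma+\eta(\delta x_1^\sigma y_1-\gamma x_1^\sigma y_0-\beta x_0^\sigma y_1+\alpha x_0^\sigma y_0),\ x_0y_1+x_1y_0)$; 6. Dempwolff: $(x_0y_0+x_1y_1^\sigma-\eta x_1^\tau y_1^{\overline\sigma},\ x_0y_1+\alpha(x_1y_0^\sigma-\eta x_1^\tau y_0^{\overline\sigma}))$ with $\alpha$ a non-square of $L$ fixed by $\sigma$; and, more generally, $x_0\mathbf y+x_1T(\mathbf y)+\eta x_1^\tau T^{-1}(\mathbf y)$ with any irreducible $T\in\Gamma L(2,L)$; 7. Zhou–Pott: $(x_0^\sigma y_0+x_0y_0^\sigma+\alpha(x_1^\sigma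 y_1+x_1y_1^\sigma)^\tau,\ x_0y_1+x_1y_0)$; 8. Taniguchi: $((x_0^\sigma y_0-\eta x_0y_0^\sigma)^{\sigma^2}+\beta(x_0^\sigma y_1+\eta y_0^\sigma x_1)^\sigma+\alpha(x_1^\sigma y_1-\eta x_1y_1^\sigma),\ x_1y_0+x_0y_1)$; 9. Albert's generalized twisted fields: $xy-c\,x^\sigma y^\tau$ on $\mathbb F_{p^{2m}}$, with $\sigma,\tau$ automorphisms of $\mathbb F_{p^{2m}}$; 10. (twisted) cyclic semifields: $\sum_{i<d}y_iT^i(\mathbf x)+\eta y_0^\rho T^d(\mathbf x)$ on $(\mathbb F_{p^n})^d$, where $d\ge 1$, $dn=2m$, $T\in\Gamma L(d,\mathbb F_{p^n})$ is irreducible and $\rho$ is an automorphism of $\mathbb F_{p^n}$. **Theorem.** The family $\mathcal S_{\sigma,\tau,\alpha,\eta}$ contains semifields that are not equivalent to any known semifield. More precisely, for every odd prime $p$ there are infinitely many $m$ for which there are parameters as above, with moreover $\eta^\tau=\eta$, such that $\mathcal S_{\sigma,\tau,\alpha,\eta}$ is a pre-semifield that is not equivalent to any known semifield of order $p^{2m}$.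 -/

import Mathlib

/-! ## Finite (pre-)semifields, isotopy, Knuth orbit, nuclei

The additive group of the semifield is the ambient type `V`; the multiplication is a function
`mul : V → V → V`. -/

namespace Semifields

/-- A pre-semifield: a biadditive multiplication without zero divisors. -/
structure IsPresemifield {V : Type*} [AddCommGroup V] (mul : V → V → V) : Prop where
  mul_add : ∀ x y z, mul x (y + z) = mul x y + mul x z
  add_mul : ∀ x y z, mul (x + y) z = mul x z + mul y z
  eq_zero_or_eq_zero : ∀ x y, mul x y = 0 → x = 0 ∨ y = 0

/-- A semifield: a pre-semifield with a two-sided identity. -/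
structure IsSemifield {V : Type*} [AddCommGroup V] (mul : V → V → V) : Prop
    extends IsPresemifield mul where
  exists_one : ∃ e, ∀ x, mul x e = x ∧ mul e x = x

/-- Isotopy. For elementary abelian `p`-groups, additive bijections are the same as
`𝔽_p`-linear bijections. -/
def Isotopic {V W : Type*} [AddCommGroup V] [AddCommGroup W]
    (mul₁ : V → V → V) (mul₂ : W → W → W) : Prop :=
  ∃ N₁ N₂ N₃ : V ≃+ W, ∀ x y, N₁ (mul₁ x y) = mul₂ (N₂ x) (N₃ y)

/-- The dual `π₁` of a semifield: the opposite multiplication. -/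
def dualMul {V : Type*} (mul : V → V → V) : V → V → V := fun x y => mul y x

/-- `mul'` is a transpose `π₂` of `mul`. The spread of `mul` consists of `{(x, mul x y) | x}`
for `y ∈ V` and `{(0, x) | x}`. With respect to the alternating form
`((u, w), (a, c)) ↦ B c u - B a w` on `V × V`, where `B` is a symmetric nondegenerate
`𝔽_p`-bilinear form on `V`, the dual spread consists of `{(a, mul' a y) | a}` and `{(0, x) | x}`
with `mul'` determined by the identity below.
Different choices of `B` lead to isotopic transposes. -/
def IsTranspose (p : ℕ) {V : Type*} [AddCommGroup V] (mul mul' : V → V → V) : Prop :=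
  ∃ B : V →+ V →+ ZMod p,
    (∀ x y, B x y = B y x) ∧ (∀ x, (∀ y, B x y = 0) → x = 0) ∧
    ∀ x a y, B (mul' a y) x = B a (mul x y)

/-- `mul'` is in the Knuth orbit of `mul`: it is one of
`S, π₁ S, π₂ S, π₂ π₁ S, π₁ π₂ S, π₁ π₂ π₁ S`. -/
def InKnuthOrbit (p : ℕ) {V : Type*} [AddCommGroup V] (mul mul' : V → V → V) : Prop :=
  mul' = mul ∨ mul' = dualMul mul ∨ IsTranspose p mul mul' ∨ IsTranspose p (dualMul mul) mul' ∨
    (∃ f, IsTranspose p mul f ∧ mul' = dualMul f) ∨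
    (∃ f, IsTranspose p (dualMul mul) f ∧ mul' = dualMul f)

/-- Equivalence: `mul₁` is isotopic to a member of the Knuth orbit of `mul₂`. -/
def Equivalent (p : ℕ) {V W : Type*} [AddCommGroup V] [AddCommGroup W]
    (mul₁ : V → V → V) (mul₂ : W → W → W) : Prop :=
  ∃ f : W → W → W, InKnuthOrbit p mul₂ f ∧ Isotopic mul₁ f

/-- Left nucleus. -/
def leftNucleus {V : Type*} (mul : V → V → V) : Set V :=
  {x | ∀ y z, mul (mul x y) z = mul x (mul y z)}

/-- Middle nucleus. -/
def middleNucleus {V : Type*} (mul : V → V → V) : Set V :=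
  {y | ∀ x z, mul (mul x y) z = mul x (mul y z)}

/-- Right nucleus. -/
def rightNucleus {V : Type*} (mul : V → V → V) : Set V :=
  {z | ∀ x y, mul (mul x y) z = mul x (mul y z)}

section Field

variable {L : Type*} [Field L]

/-- The norm from a finite field `L` to the fixed field of its automorphism `σ`,
i.e. `x · σ(x) ⋯ σ^{t-1}(x)` with `t` the order of `σ`. -/
noncomputable def fixedNorm (σ : RingAut L) (x : L) : L :=
  ∏ i ∈ Finset.range (orderOf σ), (σ ^ i) x

/-! ## The new family -/

/-- The multiplication of `𝒮_{σ,τ,α,η}` on `L × L`. -/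
def newMul (σ τ : RingAut L) (α η : L) : L × L → L × L → L × L := fun x y =>
  (x.2 * σ y.2 - η * σ x.2 * y.2 + α * (x.1 * σ y.1 - τ.symm η * σ x.1 * y.1),
   τ x.1 * y.2 + x.2 * τ y.1)

/-- The parameters of the new family: `τ ≠ id`, `σ² ≠ id`, `α ∉ L^{σ+1} L^{τ-1}`
(for `a = 0` this says `α ≠ 0`), and the norm of `η` to the fixed field of `σ` is not `1`. -/
structure IsNewParameter (σ τ : RingAut L) (α η : L) : Prop where
  tau_ne : τ ≠ 1
  sigma_sq_ne : σ ^ 2 ≠ 1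
  alpha_notMem : ∀ a b : L, b ≠ 0 → α ≠ (σ a * a) * (τ b / b)
  norm_ne : fixedNorm σ η ≠ 1

/-! ## The multiplications of the known families -/

/-- Generalized Dickson. -/
def dicksonMul (σ τ ρ : RingAut L) (α : L) : L × L → L × L → L × L := fun x y =>
  (x.1 * y.1 + α * ρ x.2 * τ y.2, σ x.1 * y.2 + x.2 * y.1)

/-- Knuth, type I. -/
def knuthIMul (σ : RingAut L) (α β : L) : L × L → L × L → L × L := fun x y =>
  (x.1 * y.1 + α * σ x.2 * σ.symm (σ.symm y.2),
   x.2 * y.1 + σ x.1 * y.2 + β * σ x.2 * σ.symm y.2)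

/-- Knuth, type II (Hughes-Kleinfeld). -/
def knuthIIMul (σ : RingAut L) (α β : L) : L × L → L × L → L × L := fun x y =>
  (x.1 * y.1 + α * σ x.2 * y.2,
   x.2 * y.1 + σ x.1 * y.2 + β * σ x.2 * y.2)

/-- Knuth, type III. -/
def knuthIIIMul (σ : RingAut L) (α β : L) : L × L → L × L → L × L := fun x y =>
  (x.1 * y.1 + α * σ.symm x.2 * σ.symm (σ.symm y.2),
   x.2 * y.1 + σ x.1 * y.2 + β * x.2 * σ.symm y.2)

/-- Knuth, type IV. -/
def knuthIVMul (σ : RingAut L) (α β : L) : L × L → L × L → L × L := fun x y =>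
  (x.1 * y.1 + α * σ.symm x.2 * y.2,
   x.2 * y.1 + σ x.1 * y.2 + β * x.2 * y.2)

/-- Bierbrauer (containing Budaghyan-Helleseth). -/
def bierbrauerMul (σ : RingAut L) (α β γ δ η : L) : L × L → L × L → L × L := fun x y =>
  (δ * x.2 * σ y.2 + γ * x.1 * σ y.2 + β * x.2 * σ y.1 + α * x.1 * σ y.1
      + η * (δ * σ x.2 * y.2 - γ * σ x.2 * y.1 - β * σ x.1 * y.2 + α * σ x.1 * y.1),
   x.1 * y.2 + x.2 * y.1)

/-- Dempwolff. -/
def dempwolffMul (σ τ : RingAut L) (α η : L) : L × L → L × L → L × L := fun x y =>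
  (x.1 * y.1 + x.2 * σ y.2 - η * τ x.2 * σ.symm y.2,
   x.1 * y.2 + α * (x.2 * σ y.1 - η * τ x.2 * σ.symm y.1))

/-- Zhou-Pott. -/
def zhouPottMul (σ τ : RingAut L) (α : L) : L × L → L × L → L × L := fun x y =>
  (σ x.1 * y.1 + x.1 * σ y.1 + α * τ (σ x.2 * y.2 + x.2 * σ y.2),
   x.1 * y.2 + x.2 * y.1)

/-- Taniguchi. -/
def taniguchiMul (σ : RingAut L) (α β η : L) : L × L → L × L → L × L := fun x y =>
  (σ (σ (σ x.1 * y.1 - η * x.1 * σ y.1)) + β * σ (σ x.1 * y.2 + η * σ y.1 * x.2)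
      + α * (σ x.2 * y.2 - η * x.2 * σ y.2),
   x.2 * y.1 + x.1 * y.2)

/-- Albert's generalized twisted fields. -/
def albertMul (σ τ : RingAut L) (c : L) : L → L → L := fun x y =>
  x * y - c * σ x * τ y

/-- The semilinear map `v ↦ M v^σ` on `L^d`. -/
def semilin {d : ℕ} (σ : RingAut L) (M : Matrix (Fin d) (Fin d) L) (v : Fin d → L) : Fin d → L :=
  M.mulVec (fun i => σ (v i))

/-- The inverse of `semilin σ M` when `M` is invertible. -/
noncomputable def semilinInv {d : ℕ} (σ : RingAut L) (M : Matrix (Fin d) (Fin d) L) (v : Fin d → L) :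
    Fin d → L :=
  fun i => σ.symm (M⁻¹.mulVec v i)

/-- `v ↦ M v^σ` is an irreducible element of `ΓL(d, L)`. -/
def IsIrreducibleSemilin {d : ℕ} (σ : RingAut L) (M : Matrix (Fin d) (Fin d) L) : Prop :=
  IsUnit M.det ∧ ∀ U : Submodule L (Fin d → L), (∀ v ∈ U, semilin σ M v ∈ U) → U = ⊥ ∨ U = ⊤

/-- (Twisted) cyclic semifields: `x ∘ y = ∑_{i<d} y_i T^i x + η y_0^ρ T^d x`. -/
def twistedCyclicMul {d : ℕ} (hd : 0 < d) (σ ρ : RingAut L) (M : Matrix (Fin d) (Fin d) L)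
    (η : L) : (Fin d → L) → (Fin d → L) → (Fin d → L) := fun x y =>
  ∑ i : Fin d, y i • (semilin σ M)^[(i : ℕ)] x
    + (η * ρ (y ⟨0, hd⟩)) • (semilin σ M)^[d] x

/-- The form `x ∘ y = x_0 y + x_1 T y + η x_1^τ T⁻¹ y` of the Dempwolff semifields. -/
noncomputable def dempwolffFormMul (σ τ : RingAut L) (M : Matrix (Fin 2) (Fin 2) L) (η : L) :
    (Fin 2 → L) → (Fin 2 → L) → (Fin 2 → L) := fun x y =>
  x 0 • y + x 1 • semilin σ M y + (η * τ (x 1)) • semilinInv σ M y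

end Field

/-- The known semifields of order `p^{2m}`. The named families are taken with all parameters for
which the displayed multiplication is a pre-semifield, so that every published choice of
parameters is included. `commutative` contains the finite fields and the semifields of
Ganley, Cohen-Ganley, Kantor(-Knuth), Budaghyan-Helleseth, Zha-Kyureghyan-Wang, …;
`largeNucleus` contains all families of semifields that are at most two-dimensional over one of
their nuclei, such as those of Cardinali-Polverino-Trombetti and
Ebert-Marino-Polverino-Trombetti. -/
inductive IsKnown (p m : ℕ) [Fact p.Prime] :
    {W : Type} → [AddCommGroup W] → (W → W → W) → Prop
  | commutative {W : Type} [AddCommGroup W] (f : W → W → W) (hcard : Nat.card W = p ^ (2 * m))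
      (hf : IsPresemifield f) (hcomm : ∀ x y, f x y = f y x) : IsKnown p m f
  | largeNucleus {W : Type} [AddCommGroup W] (f : W → W → W) (hcard : Nat.card W = p ^ (2 * m))
      (hf : IsSemifield f)
      (hnuc : p ^ m ≤ Nat.card (leftNucleus f) ∨ p ^ m ≤ Nat.card (middleNucleus f) ∨
        p ^ m ≤ Nat.card (rightNucleus f)) : IsKnown p m f
  | dickson (σ τ ρ : RingAut (GaloisField p m)) (α : GaloisField p m)
      (hf : IsPresemifield (dicksonMul σ τ ρ α)) : IsKnown p m (dicksonMul σ τ ρ α)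
  | knuthI (σ : RingAut (GaloisField p m)) (α β : GaloisField p m)
      (hf : IsPresemifield (knuthIMul σ α β)) : IsKnown p m (knuthIMul σ α β)
  | knuthII (σ : RingAut (GaloisField p m)) (α β : GaloisField p m)
      (hf : IsPresemifield (knuthIIMul σ α β)) : IsKnown p m (knuthIIMul σ α β)
  | knuthIII (σ : RingAut (GaloisField p m)) (α β : GaloisField p m)
      (hf : IsPresemifield (knuthIIIMul σ α β)) : IsKnown p m (knuthIIIMul σ α β)
  | knuthIV (σ : RingAut (GaloisField p m)) (α β : GaloisField p m)
      (hf : IsPresemifield (knuthIVMul σ α β)) : IsKnown p m (knuthIVMul σ α β)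
  | bierbrauer (σ : RingAut (GaloisField p m)) (α β γ δ η : GaloisField p m)
      (hf : IsPresemifield (bierbrauerMul σ α β γ δ η)) :
      IsKnown p m (bierbrauerMul σ α β γ δ η)
  | dempwolff (σ τ : RingAut (GaloisField p m)) (α η : GaloisField p m)
      (hfix : σ α = α) (hsq : ¬ IsSquare α)
      (hf : IsPresemifield (dempwolffMul σ τ α η)) : IsKnown p m (dempwolffMul σ τ α η)
  | dempwolffForm (σ τ : RingAut (GaloisField p m))
      (M : Matrix (Fin 2) (Fin 2) (GaloisField p m)) (η : GaloisField p m)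
      (hM : IsIrreducibleSemilin σ M) (hf : IsPresemifield (dempwolffFormMul σ τ M η)) :
      IsKnown p m (dempwolffFormMul σ τ M η)
  | zhouPott (σ τ : RingAut (GaloisField p m)) (α : GaloisField p m)
      (hf : IsPresemifield (zhouPottMul σ τ α)) : IsKnown p m (zhouPottMul σ τ α)
  | taniguchi (σ : RingAut (GaloisField p m)) (α β η : GaloisField p m)
      (hf : IsPresemifield (taniguchiMul σ α β η)) : IsKnown p m (taniguchiMul σ α β η)
  | albert (σ τ : RingAut (GaloisField p (2 * m))) (c : GaloisField p (2 * m))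
      (hf : IsPresemifield (albertMul σ τ c)) : IsKnown p m (albertMul σ τ c)
  | twistedCyclic (d n : ℕ) (hd : 0 < d) (hdn : d * n = 2 * m)
      (σ ρ : RingAut (GaloisField p n)) (M : Matrix (Fin d) (Fin d) (GaloisField p n))
      (η : GaloisField p n) (hM : IsIrreducibleSemilin σ M)
      (hf : IsPresemifield (twistedCyclicMul hd σ ρ M η)) :
      IsKnown p m (twistedCyclicMul hd σ ρ M η)

end Semifields

/-!
Choose `τ = σ ^ 3`, with `σ` of prime order `l ≥ 11` on a field `L` with `p ^ (2 * l)` elements,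
`α` a non-square and `η` a square root of `-1`. Every number `g(b) * b` with `g` an automorphism is
a square, and `N(η) = η ^ l` is not `1` since `l` is odd; hence `α` and `η` are allowed.

Equivalent multiplications have trilinear forms `B (x ∘ y) z` which differ by a permutation and a
change of coordinates of the three slots. The derivations of such a form, that is, the triples
`(X, Y, Z)` with `Z (x ∘ y) = X x ∘ y + x ∘ Y y`, are therefore an invariant. Expanding additive
maps as sums of automorphisms shows that the derivations of the new multiplication are
`X = a`, `Y = b`, `Z = (a + σ b, a + σ³ b)` with `a - b` fixed by `σ`. So there are few of them, all
nuclei are small and central, and the torus `a = b` acts on the third slot with the weights `1 + σ`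
and `1 + σ³` only. Moreover no two slots can be exchanged. Each known family violates one of these
properties: commutativity is an exchange of two slots, and the other families have too many
derivations, a noncentral nucleus, or other weights. For cyclic semifields and those of Dempwolff,
the power of the semilinear map `T` by the order of its automorphism lies in a nucleus, so it can
be moved to another slot, and this yields a relation between powers of `T` which is too short for
an irreducible map.
-/

namespace Semifields

open Finset

/-! ## Sums of field automorphisms -/

theorem ringHom_eq_or_eq_of_add_eq_add {R S : Type*} [Semiring R] [CommRing S] [IsDomain S]
    (h2 : (2 : S) ≠ 0) {θ₁ θ₂ χ₁ χ₂ : R →+* S} (h : ∀ a, θ₁ a + θ₂ a = χ₁ a + χ₂ a) :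
    (θ₁ = χ₁ ∧ θ₂ = χ₂) ∨ (θ₁ = χ₂ ∧ θ₂ = χ₁) := by
  have hprod : ∀ a, (θ₁ a - χ₁ a) * (θ₁ a - χ₂ a) = 0 := by
    intro a
    have hsq := h (a * a)
    simp only [map_mul] at hsq
    refine (mul_eq_zero.1 ?_).resolve_left h2
    linear_combination hsq + (θ₁ a - χ₁ a - χ₂ a - θ₂ a) * h a
  by_cases hχ₁ : ∀ a, θ₁ a = χ₁ a
  · exact Or.inl ⟨RingHom.ext hχ₁, RingHom.ext fun a => by linear_combination h a - hχ₁ a⟩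
  push Not at hχ₁
  obtain ⟨b, hb⟩ := hχ₁
  have hb₂ : θ₁ b - χ₂ b = 0 := (mul_eq_zero.1 (hprod b)).resolve_left (sub_ne_zero.2 hb)
  have hχ₂ : ∀ a, θ₁ a = χ₂ a := by
    intro a
    by_contra ha
    have ha₁ : θ₁ a - χ₁ a = 0 := (mul_eq_zero.1 (hprod a)).resolve_right (sub_ne_zero.2 ha)
    have hab := hprod (a + b)
    simp only [map_add] at hab
    rcases mul_eq_zero.1 hab with h0 | h0
    · exact hb (by linear_combination h0 - ha₁)
    · exact ha (by linear_combination h0 - hb₂)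
  exact Or.inr ⟨RingHom.ext hχ₂, RingHom.ext fun a => by linear_combination h a - hχ₂ a⟩

theorem eq_zero_of_sum_ringAut_smul {K V ι : Type*} [Field K] [AddCommGroup V] [Module K V]
    [Fintype ι] {g : ι → RingAut K} (hg : Function.Injective g) {v : ι → V}
    (h : ∀ c, ∑ i, g i c • v i = 0) : v = 0 := by
  have hli : LinearIndependent K fun i => ((g i : K →+* K) : K → K) :=
    (linearIndependent_monoidHom K K).comp (fun i => ((g i : K →+* K) : K →* K)) fun i j hij =>
      hg (RingEquiv.ext fun x => DFunLike.congr_fun hij x)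
  funext i
  refine (Module.forall_dual_apply_eq_zero_iff K _).1 fun φ => ?_
  refine Fintype.linearIndependent_iff.1 hli (fun i => φ (v i)) (funext fun c => ?_) i
  simpa [mul_comm] using congrArg φ (h c)

theorem eq_zero_of_sum_zpow_smul {K V ι : Type*} [Field K] [AddCommGroup V] [Module K V]
    [Fintype ι] {σ : RingAut K} {e : ι → ℤ} (he : Function.Injective e)
    (hσ : ∀ i j, (e i - e j).natAbs < orderOf σ) {v : ι → V}
    (h : ∀ c, ∑ i, (σ ^ e i) c • v i = 0) : v = 0 := by
  refine eq_zero_of_sum_ringAut_smul (g := fun i => σ ^ e i) (fun i j hij => he ?_) h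
  refine (sub_eq_zero.1 (Int.eq_zero_of_dvd_of_natAbs_lt_natAbs
    (zpow_eq_zpow_iff_modEq.1 hij).dvd (hσ j i))).symm

/-- `c` is the family of coefficients of `f` as a linear combination of the automorphisms of the
field `L`. By Dedekind's lemma it is determined by `f`. -/
def IsAutExpansion {L : Type*} [Field L] [Fintype (RingAut L)] (f : L → L) (c : RingAut L → L) :
    Prop :=
  ∀ x, f x = ∑ g, c g * g x

namespace IsAutExpansion

variable {L : Type*} [Field L] [Fintype (RingAut L)] {f f' : L → L} {c c' : RingAut L → L}

theorem unique (hc : IsAutExpansion f c) (hc' : IsAutExpansion f c') : c = c' := by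
  refine sub_eq_zero.1 (eq_zero_of_sum_ringAut_smul (g := id) Function.injective_id fun x => ?_)
  calc ∑ g, g x * (c g - c' g) = ∑ g, c g * g x - ∑ g, c' g * g x := by
        rw [← sum_sub_distrib]; exact sum_congr rfl fun g _ => by ring
    _ = 0 := by rw [← hc x, ← hc' x, sub_self]

theorem add (hc : IsAutExpansion f c) (hc' : IsAutExpansion f' c') :
    IsAutExpansion (fun x => f x + f' x) fun g => c g + c' g := fun x => by
  simp only [hc x, hc' x, add_mul, sum_add_distrib]

theorem sub (hc : IsAutExpansion f c) (hc' : IsAutExpansion f' c') :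
    IsAutExpansion (fun x => f x - f' x) fun g => c g - c' g := fun x => by
  simp only [hc x, hc' x, sub_mul, sum_sub_distrib]

theorem const_mul (hc : IsAutExpansion f c) (u : L) :
    IsAutExpansion (fun x => u * f x) fun g => u * c g := fun x => by
  simp only [hc x, mul_sum, mul_assoc]

theorem comp_const_mul (hc : IsAutExpansion f c) (u : L) :
    IsAutExpansion (fun x => f (u * x)) fun g => c g * g u := fun x => by
  simp only [hc (u * x), map_mul, mul_assoc]

theorem comp_ringAut (hc : IsAutExpansion f c) (s : RingAut L) :
    IsAutExpansion (fun x => f (s x)) fun g => c (g * s⁻¹) := fun x =>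
  (hc (s x)).trans <| Fintype.sum_equiv (Equiv.mulRight s) _ _ fun g => by simp

theorem ringAut_comp (hc : IsAutExpansion f c) (s : RingAut L) :
    IsAutExpansion (fun x => s (f x)) fun g => s (c (s⁻¹ * g)) := fun x =>
  ((congrArg s (hc x)).trans (map_sum s _ _)).trans <|
    Fintype.sum_equiv (Equiv.mulLeft s) _ _ fun g => by simp

theorem ringAut [DecidableEq (RingAut L)] (s : RingAut L) :
    IsAutExpansion s (Pi.single s 1) := fun x => by
  simp [Pi.single_apply]

end IsAutExpansion

section FiniteField

variable {L : Type*} [Field L]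

/-- Ring automorphisms of `L` are automorphisms over the prime field. -/
def ringAutEquivGal (L : Type*) [Field L] (p : ℕ) [Algebra (ZMod p) L] :
    RingAut L ≃* Gal(L/ZMod p) where
  toFun g := AlgEquiv.ofRingEquiv (f := g) fun x =>
    DFunLike.congr_fun (RingHom.ext_zmod ((g : L →+* L).comp (algebraMap (ZMod p) L)) _) x
  invFun g := g.toRingEquiv
  left_inv _ := rfl
  right_inv _ := rfl
  map_mul' _ _ := rfl

instance [Finite L] : Finite (RingAut L) := DFunLike.finite _

theorem ringAut_mul_comm [Finite L] (g h : RingAut L) : g * h = h * g := by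
  obtain ⟨p, _⟩ := CharP.exists L
  have : Fact p.Prime := ⟨(CharP.char_is_prime_or_zero L p).resolve_right
    (CharP.char_ne_zero_of_finite L p)⟩
  let := ZMod.algebra L p
  obtain ⟨s, hs⟩ := IsCyclic.exists_generator (α := Gal(L/ZMod p))
  refine (ringAutEquivGal L p).injective ?_
  obtain ⟨i, hi⟩ := hs (ringAutEquivGal L p g)
  obtain ⟨j, hj⟩ := hs (ringAutEquivGal L p h)
  rw [map_mul, map_mul, ← hi, ← hj]
  exact zpow_mul_comm s i j

theorem exists_isAutExpansion [Finite L] [Fintype (RingAut L)] (f : L →+ L) :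
    ∃ c, IsAutExpansion f c := by
  obtain ⟨p, _⟩ := CharP.exists L
  have : Fact p.Prime := ⟨(CharP.char_is_prime_or_zero L p).resolve_right
    (CharP.char_ne_zero_of_finite L p)⟩
  let := ZMod.algebra L p
  have : Finite (L →ₗ[ZMod p] L) := Module.finite_of_finite (ZMod p)
  let Φ : (RingAut L → L) → (L →ₗ[ZMod p] L) := fun c =>
    AddMonoidHom.toZModLinearMap p (AddMonoidHom.mk' (fun x => ∑ g, c g * g x) fun x y => by
      simp only [map_add, mul_add, sum_add_distrib])
  have hinj : Function.Injective Φ := fun c d hcd =>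
    IsAutExpansion.unique (f := Φ c) (fun _ => rfl) fun x => DFunLike.congr_fun hcd x
  have hcard : Nat.card (RingAut L → L) = Nat.card (L →ₗ[ZMod p] L) := by
    rw [Nat.card_fun, Nat.card_congr (ringAutEquivGal L p).toEquiv, IsGalois.card_aut_eq_finrank,
      Module.natCard_eq_pow_finrank (K := ZMod p) (V := L →ₗ[ZMod p] L), Module.finrank_linearMap,
      Module.natCard_eq_pow_finrank (K := ZMod p) (V := L), pow_mul]
  obtain ⟨c, hc⟩ := ((Nat.bijective_iff_injective_and_card Φ).2 ⟨hinj, hcard⟩).2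
    (f.toZModLinearMap p)
  exact ⟨c, fun x => DFunLike.congr_fun hc.symm x⟩

end FiniteField

/-! ## Derivations of the new family -/

/-- The multiplication of a generalized twisted field, of which the new family is built. -/
def twistedMul {L : Type*} [Field L] (σ : RingAut L) (η x y : L) : L :=
  x * σ y - η * σ x * y

/-- A derivation of a multiplication `f` with an independent additive map in each of the three
slots of the trilinear form attached to `f`. -/
def IsDerivation {V : Type*} [AddCommGroup V] (f : V → V → V) (X Y Z : V →+ V) : Prop :=
  ∀ x y, Z (f x y) = f (X x) y + f x (Y y)

section TwistedMul

variable {L : Type*} [Field L] {σ : RingAut L} {κ μ η : L}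

theorem twistedMul_swap (hη : η ≠ 0) (x y : L) :
    twistedMul σ η x y = -η * twistedMul σ η⁻¹ y x := by
  simp only [twistedMul]
  field_simp
  ring

@[simp]
theorem twistedMul_zero_left (y : L) : twistedMul σ η 0 y = 0 := by simp [twistedMul]

@[simp]
theorem twistedMul_zero_right (x : L) : twistedMul σ η x 0 = 0 := by simp [twistedMul]

theorem newMul_apply {τ : RingAut L} {α : L} (hτ : τ η = η) (x y : L × L) :
    newMul σ τ α η x y = (twistedMul σ η x.2 y.2 + α * twistedMul σ η x.1 y.1,
      τ x.1 * y.2 + x.2 * τ y.1) := by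
  simp only [newMul, twistedMul, (RingEquiv.symm_apply_eq τ).2 hτ.symm]

theorem eq_zero_of_map_mul_eq_map_mul (hσ : σ ^ 2 ≠ 1) {F G : L →+ L}
    (h : ∀ x y, F (x * σ y) = G (σ x * y)) : F = 0 ∧ G = 0 := by
  obtain ⟨y, hy⟩ := DFunLike.ne_iff.1 hσ
  have hyne : σ (σ y) - y ≠ 0 := sub_ne_zero.2 hy
  have hF : ∀ x, F x = G (σ x) := fun x => by simpa using h x 1
  have hG : ∀ x, G (σ x * (σ (σ y) - y)) = 0 := fun x => by
    rw [mul_sub, map_sub, ← map_mul, ← hF, h, sub_self]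
  have hG0 : G = 0 := AddMonoidHom.ext fun z => by
    have := hG (σ.symm (z / (σ (σ y) - y)))
    rwa [RingEquiv.apply_symm_apply, div_mul_cancel₀ _ hyne] at this
  exact ⟨AddMonoidHom.ext fun x => by rw [hF, hG0, AddMonoidHom.zero_apply,
    AddMonoidHom.zero_apply], hG0⟩

section Coefficients

variable [Fintype (RingAut L)] {A B C : L →+ L} {c : RingAut L → L}

theorem coeff_twistedMul_add {b r : RingAut L → L} {x z : L} (hσ : σ ≠ 1)
    (hb : IsAutExpansion B b)
    (hr : IsAutExpansion (fun y => κ * twistedMul σ η z y + μ * twistedMul σ η x (B y)) r) :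
    r σ = κ * z + μ * (x * σ (b 1) - η * σ x * b σ) ∧
      r 1 = -(κ * η * σ z) + μ * (x * σ (b σ⁻¹) - η * σ x * b 1) := by
  classical
  have hz := (((IsAutExpansion.ringAut σ).const_mul z).sub
    ((IsAutExpansion.ringAut 1).const_mul (η * σ z))).const_mul κ
  have hx := (((hb.ringAut_comp σ).const_mul x).sub (hb.const_mul (η * σ x))).const_mul μ
  rw [hr.unique (hz.add hx)]
  constructor
  · simp [hσ]
  · simp [hσ.symm, mul_assoc]

/-- Comparing `σ (r x σ)` with `r x 1` eliminates `A` and leaves a linear relation between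
distinct automorphisms, whose coefficients therefore vanish. -/
theorem exists_eq_mul_of_coeff (hκ : κ ≠ 0) (hη : η ≠ 0) {i j : ℤ} {u w u' w' : L}
    (he : Function.Injective ![0, 1, 2, i + 1, j])
    (hσ : ∀ k l : Fin 5, (![0, 1, 2, i + 1, j] k - ![0, 1, 2, i + 1, j] l).natAbs < orderOf σ)
    (hσ1 : σ ≠ 1) {b : RingAut L → L} (hb : IsAutExpansion B b) {r : L → RingAut L → L}
    (hr : ∀ x, IsAutExpansion
      (fun y => κ * twistedMul σ η (A x) y + μ * twistedMul σ η x (B y)) (r x))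
    (hrσ : ∀ x, r x σ = u * x + w * (σ ^ i) x)
    (hr1 : ∀ x, r x 1 = u' * σ x + w' * (σ ^ j) x) : ∃ a, ∀ x, A x = a * x := by
  have hv := eq_zero_of_sum_zpow_smul he hσ (v := ![σ κ * (μ * σ (b σ⁻¹)),
    -(σ κ * (μ * η * b 1)) - σ κ * u' - κ * η * σ u + κ * η * σ μ * σ (σ (b 1)),
    -(κ * η * σ μ * σ η * σ (b σ)), -(κ * η * σ w), -(σ κ * w')]) fun x => by
    obtain ⟨h₁, h₂⟩ := coeff_twistedMul_add hσ1 hb (hr x)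
    rw [hrσ] at h₁
    rw [hr1] at h₂
    have h₁σ := congrArg σ h₁
    have hi : σ ((σ ^ i) x) = (σ ^ (i + 1)) x := by rw [add_comm, zpow_one_add]; rfl
    simp only [map_add, map_sub, map_mul, hi] at h₁σ
    simp only [Fin.sum_univ_five, Matrix.cons_val, zpow_ofNat, pow_zero, pow_one,
      pow_two, RingAut.one_apply, RingAut.mul_apply, smul_eq_mul]
    linear_combination -σ κ * h₂ - κ * η * h₁σ
  have hbσ : μ * b σ = 0 := by
    have := congrFun hv 2
    simpa [hκ, hη] using this
  have hw : w = 0 := by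
    have := congrFun hv 3
    simpa [hκ, hη] using this
  refine ⟨(u - μ * σ (b 1)) / κ, fun x => ?_⟩
  have h₁ := (coeff_twistedMul_add hσ1 hb (hr x)).1
  rw [hrσ, hw] at h₁
  field_simp
  linear_combination -h₁ + η * σ x * hbσ

theorem expansion_map_twistedMul (hc : IsAutExpansion C c) (x : L) :
    IsAutExpansion (fun y => C (twistedMul σ η x y))
      fun g => c (g * σ⁻¹) * (g * σ⁻¹) x - c g * g (η * σ x) := fun y =>
  (map_sub C (x * σ y) (η * σ x * y)).trans
    (((hc.comp_const_mul x).comp_ringAut σ).sub (hc.comp_const_mul (η * σ x)) y)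

end Coefficients

section Scalars

variable [Finite L] {A B C D : L →+ L}

theorem exists_eq_mul_of_map_twistedMul (hκ : κ ≠ 0) (hη : η ≠ 0) (hσ : 5 < orderOf σ)
    (h : ∀ x y, C (twistedMul σ η x y) =
      κ * twistedMul σ η (A x) y + μ * twistedMul σ η x (B y)) : ∃ a, ∀ x, A x = a * x := by
  have := Fintype.ofFinite (RingAut L)
  obtain ⟨b, hb⟩ := exists_isAutExpansion B
  obtain ⟨c, hc⟩ := exists_isAutExpansion C
  refine exists_eq_mul_of_coeff hκ hη (i := 2) (j := -1) (u := c 1) (w := -(c σ * σ η))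
    (u' := -(c 1 * η)) (w' := c σ⁻¹) (by decide) (fun k l => lt_of_le_of_lt ?_ hσ) ?_ hb
    (fun x => funext (h x) ▸ expansion_map_twistedMul hc x) (fun x => ?_) fun x => ?_
  · decide +revert
  · rintro rfl; simp at hσ
  · simp [pow_two]; ring
  · simp; ring

theorem exists_eq_mul_of_map_cube_mul (hκ : κ ≠ 0) (hη : η ≠ 0) (hσ : 5 < orderOf σ)
    (h : ∀ x y, D ((σ ^ 3) x * y) =
      κ * twistedMul σ η (A x) y + μ * twistedMul σ η x (B y)) : ∃ a, ∀ x, A x = a * x := by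
  have := Fintype.ofFinite (RingAut L)
  obtain ⟨b, hb⟩ := exists_isAutExpansion B
  obtain ⟨d, hd⟩ := exists_isAutExpansion D
  refine exists_eq_mul_of_coeff hκ hη (i := 4) (j := 3) (u := 0) (w := d σ) (u' := 0)
    (w' := d 1) (by decide) (fun k l => lt_of_le_of_lt ?_ hσ) ?_ hb
    (fun x => funext (h x) ▸ hd.comp_const_mul ((σ ^ 3) x)) (fun x => ?_) fun x => ?_
  · decide +revert
  · rintro rfl; simp at hσ
  · simp [pow_succ]
  · simp [pow_succ]

theorem exists_eq_mul_of_map_mul_cube (hκ : κ ≠ 0) (hη : η ≠ 0) (hσ : 5 < orderOf σ)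
    (h : ∀ x y, D (x * (σ ^ 3) y) =
      κ * twistedMul σ η (A x) y + μ * twistedMul σ η x (B y)) : ∃ a, ∀ x, A x = a * x := by
  have := Fintype.ofFinite (RingAut L)
  obtain ⟨b, hb⟩ := exists_isAutExpansion B
  obtain ⟨d, hd⟩ := exists_isAutExpansion D
  refine exists_eq_mul_of_coeff hκ hη (i := -2) (j := -3) (u := 0) (w := d (σ ^ (-2 : ℤ)))
    (u' := 0) (w' := d (σ ^ (-3 : ℤ))) (by decide) (fun k l => lt_of_le_of_lt ?_ hσ) ?_ hb
    (fun x => funext (h x) ▸ (hd.comp_const_mul x).comp_ringAut (σ ^ 3)) (fun x => ?_) fun x => ?_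
  · decide +revert
  · rintro rfl; simp at hσ
  · have : σ * (σ ^ 3)⁻¹ = σ ^ (-2 : ℤ) := by group
    simp [this]
  · have : (1 : RingAut L) * (σ ^ 3)⁻¹ = σ ^ (-3 : ℤ) := by group
    simp [this]

theorem scalar_of_map_twistedMul (hκ : κ ≠ 0) (hμ : μ ≠ 0) (hη : η ≠ 0)
    (hσ : 5 < orderOf σ) (h : ∀ x y, C (twistedMul σ η x y) =
      κ * twistedMul σ η (A x) y + μ * twistedMul σ η x (B y)) :
    ∃ a b, (∀ x, A x = a * x) ∧ (∀ x, B x = b * x) ∧ (∀ x, C x = (κ * a + μ * σ b) * x) ∧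
      κ * σ a + μ * b = κ * a + μ * σ b := by
  obtain ⟨a, ha⟩ := exists_eq_mul_of_map_twistedMul hκ hη hσ h
  obtain ⟨b, hb⟩ := exists_eq_mul_of_map_twistedMul (C := C.comp (AddMonoidHom.mulLeft (-η)))
    (A := B) (B := A) (κ := -η * μ) (μ := -η * κ)
    (mul_ne_zero (neg_ne_zero.2 hη) hμ) (inv_ne_zero hη) hσ fun x y => by
      change C (-η * twistedMul σ η⁻¹ x y) = _
      rw [← twistedMul_swap hη, h, twistedMul_swap hη (A y), twistedMul_swap hη y]
      ring
  obtain ⟨hF, hG⟩ := eq_zero_of_map_mul_eq_map_mul (σ := σ)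
    (pow_ne_one_of_lt_orderOf two_ne_zero (by lia))
    (F := C - AddMonoidHom.mulLeft (κ * a + μ * σ b))
    (G := C.comp (AddMonoidHom.mulLeft η) - AddMonoidHom.mulLeft (η * (κ * σ a + μ * b)))
    fun x y => by
      have hxy := h x y
      simp only [twistedMul, ha, hb, map_mul, map_sub] at hxy
      change C (x * σ y) - (κ * a + μ * σ b) * (x * σ y) =
        C (η * (σ x * y)) - η * (κ * σ a + μ * b) * (σ x * y)
      rw [← mul_assoc η]
      linear_combination hxy
  have hC : ∀ x, C x = (κ * a + μ * σ b) * x := fun x => sub_eq_zero.1 (DFunLike.congr_fun hF x)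
  refine ⟨a, b, ha, hb, hC, mul_left_cancel₀ hη ?_⟩
  have h1 : C (η * 1) - η * (κ * σ a + μ * b) * 1 = 0 := DFunLike.congr_fun hG 1
  rw [hC] at h1
  linear_combination -h1

theorem scalar_of_map_mul_cube (hκ : κ ≠ 0) (hμ : μ ≠ 0) (hη : η ≠ 0)
    (hσ : 5 < orderOf σ) (h : ∀ x y, D (x * (σ ^ 3) y) =
      κ * twistedMul σ η (A x) y + μ * twistedMul σ η x (B y)) :
    (∃ a, ∀ x, A x = a * x) ∧ ∃ b, ∀ x, B x = b * x := by
  refine ⟨exists_eq_mul_of_map_mul_cube hκ hη hσ h,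
    exists_eq_mul_of_map_cube_mul (D := D) (κ := -η * μ) (B := A) (μ := -η * κ)
      (mul_ne_zero (neg_ne_zero.2 hη) hμ) (inv_ne_zero hη) hσ fun x y => ?_⟩
  rw [mul_comm, h, twistedMul_swap hη, twistedMul_swap hη y]
  ring

theorem scalar_of_map_cube_mul (hκ : κ ≠ 0) (hμ : μ ≠ 0) (hη : η ≠ 0)
    (hσ : 5 < orderOf σ) (h : ∀ x y, D ((σ ^ 3) x * y) =
      κ * twistedMul σ η (A x) y + μ * twistedMul σ η x (B y)) :
    (∃ a, ∀ x, A x = a * x) ∧ (∃ b, ∀ x, B x = b * x) ∧ D = 0 := by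
  obtain ⟨⟨b, hb⟩, a, ha⟩ := scalar_of_map_mul_cube (D := D) (A := B) (κ := -η * μ)
    (B := A) (μ := -η * κ) (mul_ne_zero (neg_ne_zero.2 hη) hμ)
    (mul_ne_zero (neg_ne_zero.2 hη) hκ) (inv_ne_zero hη) hσ fun x y => by
      rw [mul_comm, h, twistedMul_swap hη, twistedMul_swap hη y]
      ring
  refine ⟨⟨a, ha⟩, ⟨b, hb⟩, ?_⟩
  have hD : ∀ x y, D ((σ ^ 3) x * y) =
      (κ * a + μ * σ b) * (x * σ y) - η * (κ * σ a + μ * b) * (σ x * y) := fun x y => by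
    rw [h, ha, hb]
    simp only [twistedMul, map_mul]
    ring
  have hpq := eq_zero_of_sum_zpow_smul (σ := σ) (e := ![0, 1, 3, 4]) (by decide)
    (fun i j => lt_of_le_of_lt (b := 4) (by decide +revert) (by lia))
    (v := ![κ * a + μ * σ b, -(η * (κ * σ a + μ * b)), η * (κ * σ a + μ * b),
      -(κ * a + μ * σ b)]) fun y => by
    have h₁ := hD 1 ((σ ^ 3) y)
    have h₂ := hD y 1
    simp only [map_one, one_mul, mul_one] at h₁ h₂
    have h₄ : σ ((σ ^ 3) y) = (σ ^ 4) y := by rw [pow_succ' σ 3]; rfl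
    rw [h₄] at h₁
    simp only [Fin.sum_univ_four, Matrix.cons_val, zpow_ofNat, pow_zero, pow_one,
      RingAut.one_apply, smul_eq_mul]
    linear_combination h₁ - h₂
  have hp : κ * a + μ * σ b = 0 := congrFun hpq 0
  have hq : η * (κ * σ a + μ * b) = 0 := congrFun hpq 2
  refine AddMonoidHom.ext fun x => ?_
  have := hD ((σ ^ 3).symm x) 1
  rwa [hp, hq, zero_mul, zero_mul, sub_zero, mul_one, RingEquiv.apply_symm_apply] at this

theorem eq_zero_of_map_twistedMul_eq_cube (hσ : 5 < orderOf σ) {u w : L}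
    (h : ∀ x y, C (twistedMul σ η x y) = u * (σ ^ 3) x * y + w * x * (σ ^ 3) y) :
    u = 0 ∧ w = 0 ∧ C = 0 := by
  classical
  have := Fintype.ofFinite (RingAut L)
  obtain ⟨c, hc⟩ := exists_isAutExpansion C
  have hcoef : ∀ x g, c (g * σ⁻¹) * (g * σ⁻¹) x - c g * g (η * σ x) =
      (if g = 1 then u * (σ ^ 3) x else 0) + if g = σ ^ 3 then w * x else 0 := fun x g => by
    have hx : IsAutExpansion (fun y => C (twistedMul σ η x y)) _ :=
      fun y => (h x y).trans (((IsAutExpansion.ringAut 1).const_mul (u * (σ ^ 3) x)).add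
        ((IsAutExpansion.ringAut (σ ^ 3)).const_mul (w * x)) y)
    simpa [Pi.single_apply] using congrFun ((expansion_map_twistedMul hc x).unique hx) g
  have hσ3 : σ ^ 3 ≠ 1 := pow_ne_one_of_lt_orderOf three_ne_zero (by lia)
  have hu := eq_zero_of_sum_zpow_smul (σ := σ) (e := ![-1, 1, 3]) (by decide)
    (fun i j => lt_of_le_of_lt (b := 4) (by decide +revert) (by lia))
    (v := ![c σ⁻¹, -(c 1 * η), -u]) fun x => by
    have := hcoef x 1
    simp only [one_mul, if_true, hσ3.symm, if_false, add_zero, RingAut.one_apply] at this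
    simp only [Fin.sum_univ_three, Matrix.cons_val, zpow_ofNat, zpow_neg, pow_one, smul_eq_mul]
    linear_combination this
  have hw := eq_zero_of_sum_zpow_smul (σ := σ) (e := ![2, 4, 0]) (by decide)
    (fun i j => lt_of_le_of_lt (b := 4) (by decide +revert) (by lia))
    (v := ![c (σ ^ 2), -(c (σ ^ 3) * (σ ^ 3) η), -w]) fun x => by
    have := hcoef x (σ ^ 3)
    have h₂ : σ ^ 3 * σ⁻¹ = σ ^ 2 := by group
    have h₄ : (σ ^ 3) (σ x) = (σ ^ 4) x := by rw [pow_succ σ 3]; rfl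
    simp only [h₂, if_true, hσ3, if_false, zero_add, map_mul, h₄] at this
    simp only [Fin.sum_univ_three, Matrix.cons_val, zpow_ofNat, pow_zero, RingAut.one_apply,
      smul_eq_mul]
    linear_combination this
  have hu0 : u = 0 := neg_eq_zero.1 (congrFun hu 2)
  have hw0 : w = 0 := neg_eq_zero.1 (congrFun hw 2)
  refine ⟨hu0, hw0, (eq_zero_of_map_mul_eq_map_mul (σ := σ)
    (pow_ne_one_of_lt_orderOf two_ne_zero (by lia))
    (G := C.comp (AddMonoidHom.mulLeft η)) fun x y => ?_).1⟩
  have := h x y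
  rw [hu0, hw0, twistedMul, map_sub, mul_assoc η] at this
  change C (x * σ y) = C (η * (σ x * y))
  linear_combination this

end Scalars

end TwistedMul

section NewMul

variable {L : Type*} [Field L] {σ : RingAut L} {α η : L}

theorem exists_entries {L : Type*} [AddCommGroup L] (A : L × L →+ L × L) :
    ∃ A₁ A₂ A₃ A₄ : L →+ L, ∀ x, A x = (A₁ x.1 + A₂ x.2, A₃ x.1 + A₄ x.2) := by
  refine ⟨(AddMonoidHom.fst L L).comp (A.comp (AddMonoidHom.inl L L)),
    (AddMonoidHom.fst L L).comp (A.comp (AddMonoidHom.inr L L)),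
    (AddMonoidHom.snd L L).comp (A.comp (AddMonoidHom.inl L L)),
    (AddMonoidHom.snd L L).comp (A.comp (AddMonoidHom.inr L L)), fun x => ?_⟩
  have : A x = A (x.1, 0) + A (0, x.2) := by rw [← map_add, Prod.fst_add_snd]
  rw [this]
  rfl

theorem derivation_parameters_eq (hodd : ∀ u, σ u = -u → u = 0) {a a' b b' : L}
    (hab : σ a + b = a + σ b) (hab' : σ a' + b' = a' + σ b') (hC₁ : a' + σ b' = a + σ b)
    (hC₄ : (σ ^ 3) a' + b = a + (σ ^ 3) b') : a' = a ∧ b' = b := by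
  have hfix : σ (a' - b') = a' - b' := by
    rw [map_sub]
    linear_combination hab'
  have hfix₃ : (σ ^ 3) (a' - b') = a' - b' := by
    change σ (σ (σ (a' - b'))) = _
    simp only [hfix]
  rw [map_sub] at hfix₃
  have ha : a' - a = 0 := hodd _ (by
    rw [map_sub]
    linear_combination hC₁ + hab' - hab + hC₄ - hfix₃)
  exact ⟨sub_eq_zero.1 ha, by linear_combination ha - hC₄ + hfix₃⟩

theorem coeff_eq_zero_of_mul_map_add_map_mul {τ : RingAut L} (hτ : τ ≠ 1) {u w : L}
    (h : ∀ x y, u * x * τ y + τ x * (w * y) = 0) : u = 0 ∧ w = 0 := by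
  obtain ⟨y, hy⟩ := DFunLike.ne_iff.1 hτ
  have h₁ := h 1 1
  have h₂ := h 1 y
  simp only [map_one, mul_one, one_mul] at h₁ h₂
  have hu : u * (τ y - y) = 0 := by linear_combination h₂ - y * h₁
  have hu0 := (mul_eq_zero.1 hu).resolve_right (sub_ne_zero.2 hy)
  exact ⟨hu0, by rwa [hu0, zero_add] at h₁⟩

theorem scalar_of_diagonal [Finite L] (hα : α ≠ 0) (hη : η ≠ 0) (hσ : 5 < orderOf σ)
    (hodd : ∀ u, σ u = -u → u = 0) {A₁ A₄ B₁ B₄ C₁ C₄ : L →+ L}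
    (h₁₁ : ∀ x y, C₁ (α * twistedMul σ η x y) =
      α * twistedMul σ η (A₁ x) y + α * twistedMul σ η x (B₁ y))
    (h₂₂ : ∀ x y, C₁ (twistedMul σ η x y) = twistedMul σ η (A₄ x) y + twistedMul σ η x (B₄ y))
    (h₁₂ : ∀ x y, C₄ ((σ ^ 3) x * y) = (σ ^ 3) (A₁ x) * y + (σ ^ 3) x * B₄ y)
    (h₂₁ : ∀ x y, C₄ (x * (σ ^ 3) y) = A₄ x * (σ ^ 3) y + x * (σ ^ 3) (B₁ y)) :
    ∃ a b, σ (a - b) = a - b ∧ (∀ x, A₁ x = a * x ∧ A₄ x = a * x) ∧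
      (∀ x, B₁ x = b * x ∧ B₄ x = b * x) ∧
      ∀ x, C₁ x = (a + σ b) * x ∧ C₄ x = (a + (σ ^ 3) b) * x := by
  obtain ⟨a, b, hA₄, hB₄, hC₁, hab⟩ := scalar_of_map_twistedMul one_ne_zero one_ne_zero hη hσ
    (A := A₄) (B := B₄) (C := C₁) fun x y => by rw [h₂₂, one_mul, one_mul]
  obtain ⟨a', b', hA₁, hB₁, hC₁', hab'⟩ := scalar_of_map_twistedMul hα hα hη hσ
    (A := A₁) (B := B₁) (C := C₁.comp (AddMonoidHom.mulLeft α)) h₁₁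
  have hC₄ : ∀ x, C₄ x = ((σ ^ 3) a' + b) * x := fun x => by
    have := h₁₂ 1 x
    rwa [map_one, one_mul, hA₁, hB₄, mul_one, one_mul, ← add_mul] at this
  have hC₄' := h₂₁ 1 1
  rw [map_one, one_mul, hC₄, hA₄, hB₁] at hC₄'
  simp only [one_mul, mul_one] at hab hC₁ hC₄'
  have hαC : C₁ (α * 1) = (α * a' + α * σ b') * 1 := hC₁' 1
  obtain ⟨rfl, rfl⟩ := derivation_parameters_eq hodd hab
    (mul_left_cancel₀ hα (by linear_combination hab'))
    (mul_left_cancel₀ hα (by linear_combination hC₁ (α * 1) - hαC)) hC₄'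
  refine ⟨a', b', ?_, fun x => ⟨hA₁ x, hA₄ x⟩, fun x => ⟨hB₁ x, hB₄ x⟩,
    fun x => ⟨hC₁ x, (hC₄ x).trans (by rw [hC₄'])⟩⟩
  rw [map_sub]
  linear_combination hab

theorem scalar_of_isDerivation_newMul [Finite L] (hα : α ≠ 0) (hη : η ≠ 0) (hση : σ η = η)
    (hσ : 5 < orderOf σ) (hodd : ∀ u, σ u = -u → u = 0) {A B C : L × L →+ L × L}
    (h : IsDerivation (newMul σ (σ ^ 3) α η) A B C) :
    ∃ a b, σ (a - b) = a - b ∧ (∀ x, A x = a • x) ∧ (∀ x, B x = b • x) ∧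
      ∀ x, C x = ((a + σ b) * x.1, (a + (σ ^ 3) b) * x.2) := by
  obtain ⟨A₁, A₂, A₃, A₄, hA⟩ := exists_entries A
  obtain ⟨B₁, B₂, B₃, B₄, hB⟩ := exists_entries B
  obtain ⟨C₁, C₂, C₃, C₄, hC⟩ := exists_entries C
  have hτη : (σ ^ 3) η = η := by
    change σ (σ (σ η)) = η
    simp only [hση]
  simp only [IsDerivation, newMul_apply hτη, hA, hB, hC, Prod.mk_add_mk, Prod.mk.injEq] at h
  have h₁₁ := fun x y => h (x, 0) (y, 0)
  have h₁₂ := fun x y => h (x, 0) (0, y)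
  have h₂₁ := fun x y => h (0, x) (y, 0)
  have h₂₂ := fun x y => h (0, x) (0, y)
  simp only [map_zero, mul_zero, zero_mul, zero_add, add_zero, twistedMul_zero_left,
    twistedMul_zero_right] at h₁₁ h₁₂ h₂₁ h₂₂
  obtain ⟨⟨a₃, hA₃⟩, ⟨b₂, hB₂⟩, rfl⟩ := scalar_of_map_cube_mul one_ne_zero hα hη hσ
    (A := A₃) (B := B₂) (D := C₂) fun x y => by rw [(h₁₂ x y).1, one_mul]
  obtain ⟨⟨a₂, hA₂⟩, ⟨b₃, hB₃⟩⟩ := scalar_of_map_mul_cube hα one_ne_zero hη hσ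
    (A := A₂) (B := B₃) (D := 0) fun x y => by rw [(h₂₁ x y).1, one_mul]
  obtain ⟨ha₂, hb₂, rfl⟩ := eq_zero_of_map_twistedMul_eq_cube hσ
    (C := C₃) (u := (σ ^ 3) a₂) (w := (σ ^ 3) b₂) fun x y => by
      rw [(h₂₂ x y).2, hA₂, hB₂, map_mul, map_mul]
      ring
  obtain ⟨rfl, rfl⟩ := coeff_eq_zero_of_mul_map_add_map_mul (τ := σ ^ 3) (u := a₃) (w := b₃)
    (pow_ne_one_of_lt_orderOf three_ne_zero (by lia)) fun x y => by
      rw [← hA₃, ← hB₃, ← (h₁₁ x y).2, AddMonoidHom.zero_apply]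
  obtain ⟨a, b, hab, hA', hB', hC'⟩ := scalar_of_diagonal hα hη hσ hodd
    (fun x y => (h₁₁ x y).1) (fun x y => (h₂₂ x y).1) (fun x y => (h₁₂ x y).2)
    fun x y => (h₂₁ x y).2
  rw [map_eq_zero] at ha₂ hb₂
  exact ⟨a, b, hab, fun x => by simp [hA, hA', hA₂, hA₃, ha₂, Prod.ext_iff],
    fun x => by simp [hB, hB', hB₂, hB₃, hb₂, Prod.ext_iff], fun x => by simp [hC, hC']⟩

end NewMul

/-! ## Trilinear forms -/

/-- A symmetric nondegenerate form with values in the prime field, as in the definition of the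
transpose. -/
structure IsSymmNondegenerate {p : ℕ} {V : Type*} [AddCommGroup V] (B : V →+ V →+ ZMod p) :
    Prop where
  symm : ∀ x y, B x y = B y x
  nondegenerate : ∀ x, (∀ y, B x y = 0) → x = 0

namespace IsSymmNondegenerate

variable {p : ℕ} {V W : Type*} [AddCommGroup V] [AddCommGroup W]
  {B : V →+ V →+ ZMod p} {B' : W →+ W →+ ZMod p}

theorem ext (hB : IsSymmNondegenerate B) {x y : V} (h : ∀ z, B x z = B y z) : x = y := by
  refine sub_eq_zero.1 (hB.nondegenerate _ fun z => ?_)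
  rw [map_sub, AddMonoidHom.sub_apply, h, sub_self]

theorem compHom (hB : IsSymmNondegenerate B) (e : W ≃+ V) :
    IsSymmNondegenerate (((B.comp (e : W →+ V)).flip.comp (e : W →+ V)).flip) where
  symm x y := hB.symm (e x) (e y)
  nondegenerate x hx := e.map_eq_zero_iff.1 <| hB.nondegenerate _ fun y => by
    simpa using hx (e.symm y)

theorem nsmul_eq_zero (hB : IsSymmNondegenerate B) (x : V) : p • x = 0 :=
  hB.nondegenerate _ fun y => by simp

theorem exists_apply_eq_of_module [Fact p.Prime] [Finite V] [Module (ZMod p) V]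
    (hB : IsSymmNondegenerate B) (f : V →+ ZMod p) : ∃ v, ∀ x, B v x = f x := by
  let Φ : V →ₗ[ZMod p] Module.Dual (ZMod p) V := LinearMap.mk₂ (ZMod p) (fun x y => B x y)
    (fun x y z => by rw [map_add, AddMonoidHom.add_apply])
    (fun c x y => ZMod.map_smul (B.flip y) c x)
    (fun x y z => map_add _ _ _) (fun c x y => ZMod.map_smul (B x) c y)
  have hinj : Function.Injective Φ := fun x y hxy => hB.ext fun z => DFunLike.congr_fun hxy z
  have hsurj := (LinearMap.injective_iff_surjective_of_finrank_eq_finrank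
    (Subspace.dual_finrank_eq (K := ZMod p) (V := V)).symm).1 hinj
  obtain ⟨v, hv⟩ := hsurj (f.toZModLinearMap p)
  exact ⟨v, fun x => DFunLike.congr_fun hv x⟩

theorem exists_apply_eq [Fact p.Prime] [Finite V] (hB : IsSymmNondegenerate B) (f : V →+ ZMod p) :
    ∃ v, ∀ x, B v x = f x :=
  let := AddCommGroup.zmodModule hB.nsmul_eq_zero
  hB.exists_apply_eq_of_module f

theorem exists_adjoint [Fact p.Prime] [Finite V] (hB : IsSymmNondegenerate B)
    (B' : W →+ W →+ ZMod p) (Q : V →+ W) : ∃ R : W →+ V, ∀ w v, B (R w) v = B' w (Q v) := by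
  choose R hR using fun w => hB.exists_apply_eq ((B' w).comp Q)
  refine ⟨AddMonoidHom.mk' R fun x y => hB.ext fun z => ?_, hR⟩
  rw [map_add, AddMonoidHom.add_apply, hR, hR, hR, map_add]
  rfl

theorem exists_adjoint_equiv [Fact p.Prime] [Finite V] [Finite W] (hB : IsSymmNondegenerate B)
    (hB' : IsSymmNondegenerate B') (Q : V ≃+ W) :
    ∃ R : W ≃+ V, ∀ w v, B (R w) v = B' w (Q v) := by
  obtain ⟨R, hR⟩ := hB.exists_adjoint B' (Q : V →+ W)
  have hinj : Function.Injective R := fun x y hxy => hB'.ext fun z => by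
    have h₁ := hR x (Q.symm z)
    rw [hxy, hR y] at h₁
    simpa using h₁.symm
  have hbij := (Nat.bijective_iff_injective_and_card R).2 ⟨hinj, Nat.card_congr Q.symm.toEquiv⟩
  exact ⟨AddEquiv.ofBijective R hbij, hR⟩

end IsSymmNondegenerate

variable {p : ℕ} {U V W : Type*} [AddCommGroup U] [AddCommGroup V] [AddCommGroup W]

/-- The trilinear form `B (f x y) z` of a multiplication `f`, with its arguments indexed by
`Fin 3` so that they can be permuted. -/
def triForm (B : W →+ W →+ ZMod p) (f : W → W → W) (w : Fin 3 → W) : ZMod p :=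
  B (f (w 0) (w 1)) (w 2)

/-- The derivations of a trilinear form: triples of additive maps, one for each argument. -/
def derivations (t : (Fin 3 → W) → ZMod p) : Set (Fin 3 → W →+ W) :=
  {D | ∀ w, ∑ i, t (Function.update w i (D i (w i))) = 0}

/-- Equivalence of trilinear forms up to a permutation of the arguments; this is the relation on
trilinear forms that corresponds to `Equivalent`. -/
structure TriFormEquiv (t : (Fin 3 → V) → ZMod p) (t' : (Fin 3 → W) → ZMod p) where
  perm : Equiv.Perm (Fin 3)
  map : Fin 3 → V ≃+ W
  apply_eq : ∀ x, t x = t' fun i => map i (x (perm i))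

namespace TriFormEquiv

variable {t : (Fin 3 → V) → ZMod p} {t' : (Fin 3 → W) → ZMod p} {t'' : (Fin 3 → U) → ZMod p}

/-- The inverse of an equivalence of trilinear forms. -/
def symm (E : TriFormEquiv t t') : TriFormEquiv t' t where
  perm := E.perm.symm
  map i := (E.map (E.perm.symm i)).symm
  apply_eq x := by simp [E.apply_eq]

/-- The composition of two equivalences of trilinear forms. -/
def trans (E : TriFormEquiv t t') (E' : TriFormEquiv t' t'') : TriFormEquiv t t'' where
  perm := E.perm * E'.perm
  map i := (E.map (E'.perm i)).trans (E'.map i)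
  apply_eq x := by rw [E.apply_eq, E'.apply_eq]; rfl

/-- Transport of a triple of endomorphisms along an equivalence of trilinear forms. -/
def conj (E : TriFormEquiv t t') (D : Fin 3 → W →+ W) (j : Fin 3) : V →+ V :=
  ((E.map (E.perm.symm j)).symm : W →+ V).comp
    ((D (E.perm.symm j)).comp (E.map (E.perm.symm j) : V →+ W))

theorem conj_apply (E : TriFormEquiv t t') (D : Fin 3 → W →+ W) (j : Fin 3) (x : V) :
    E.conj D j x = (E.map (E.perm.symm j)).symm
      (D (E.perm.symm j) (E.map (E.perm.symm j) x)) := rfl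

theorem conj_mem (E : TriFormEquiv t t') {D : Fin 3 → W →+ W} (hD : D ∈ derivations t') :
    E.conj D ∈ derivations t := by
  intro x
  rw [← Equiv.sum_comp E.perm, ← hD fun i => E.map i (x (E.perm i))]
  refine sum_congr rfl fun i _ => ?_
  rw [E.apply_eq]
  congr 1
  funext j
  by_cases hj : j = i
  · subst hj
    simp [conj_apply]
  · simp [Function.update_of_ne hj, Function.update_of_ne (E.perm.injective.ne hj)]

theorem conj_congr (E : TriFormEquiv t t') {D D' : Fin 3 → W →+ W} {j : Fin 3}
    (h : D (E.perm.symm j) = D' (E.perm.symm j)) : E.conj D j = E.conj D' j := by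
  rw [conj, conj, h]

theorem conj_eq_zero (E : TriFormEquiv t t') {D : Fin 3 → W →+ W} {j : Fin 3}
    (h : D (E.perm.symm j) = 0) : E.conj D j = 0 := by
  rw [conj, h, AddMonoidHom.zero_comp, AddMonoidHom.comp_zero]

theorem conj_symm_conj (E : TriFormEquiv t t') (D : Fin 3 → W →+ W) :
    E.symm.conj (E.conj D) = D := by
  funext j
  ext x
  simp [conj_apply, symm]

theorem conj_injective (E : TriFormEquiv t t') : Function.Injective E.conj :=
  Function.LeftInverse.injective E.conj_symm_conj

end TriFormEquiv

theorem mem_derivations_triForm {B : W →+ W →+ ZMod p} {f : W → W → W} {D : Fin 3 → W →+ W} :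
    D ∈ derivations (triForm B f) ↔
      ∀ x y z, B (f (D 0 x) y) z + B (f x (D 1 y)) z + B (f x y) (D 2 z) = 0 := by
  refine ⟨fun h x y z => ?_, fun h w => ?_⟩
  · simpa [Fin.sum_univ_three, triForm, Function.update] using h ![x, y, z]
  · simpa [Fin.sum_univ_three, triForm, Function.update] using h (w 0) (w 1) (w 2)

theorem IsDerivation.exists_mem_derivations [Fact p.Prime] [Finite W] {B : W →+ W →+ ZMod p}
    (hB : IsSymmNondegenerate B) {f : W → W → W} {X Y Z : W →+ W} (h : IsDerivation f X Y Z) :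
    ∃ R : W →+ W, (∀ x y, B (R x) y = B x (Z y)) ∧ ![X, Y, -R] ∈ derivations (triForm B f) := by
  obtain ⟨R, hR⟩ := hB.exists_adjoint B Z
  refine ⟨R, hR, mem_derivations_triForm.2 fun x y z => ?_⟩
  change B (f (X x) y) z + B (f x (Y y)) z + B (f x y) (-(R z)) = 0
  rw [← AddMonoidHom.add_apply, ← map_add, ← h, map_neg,
    hB.symm (f x y) (R z), hR, hB.symm z, add_neg_cancel]

theorem exists_isDerivation_of_mem_derivations [Fact p.Prime] [Finite W] {B : W →+ W →+ ZMod p}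
    (hB : IsSymmNondegenerate B) {f : W → W → W} {D : Fin 3 → W →+ W}
    (h : D ∈ derivations (triForm B f)) :
    ∃ Z : W →+ W, (∀ x y, B (Z x) y = B x (-D 2 y)) ∧ IsDerivation f (D 0) (D 1) Z := by
  obtain ⟨Z, hZ⟩ := hB.exists_adjoint B (-D 2)
  refine ⟨Z, hZ, fun x y => hB.ext fun z => ?_⟩
  rw [hZ, AddMonoidHom.neg_apply, map_neg, map_add, AddMonoidHom.add_apply]
  exact (eq_neg_of_add_eq_zero_left (mem_derivations_triForm.1 h x y z)).symm

theorem isDerivation_of_mem_derivations {B : W →+ W →+ ZMod p} (hB : IsSymmNondegenerate B)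
    {f : W → W → W} {D : Fin 3 → W →+ W} (h : D ∈ derivations (triForm B f)) (h₂ : D 2 = 0) :
    IsDerivation f (D 0) (D 1) 0 := fun x y => hB.ext fun z => by
  have hxyz := mem_derivations_triForm.1 h x y z
  rw [h₂, AddMonoidHom.zero_apply, map_zero, add_zero] at hxyz
  rw [AddMonoidHom.zero_apply, map_zero, AddMonoidHom.zero_apply, map_add,
    AddMonoidHom.add_apply, hxyz]

theorem Equivalent.exists_triFormEquiv [Fact p.Prime] [Finite V] {g : V → V → V} {f : W → W → W}
    {B₀ : V →+ V →+ ZMod p} (hB₀ : IsSymmNondegenerate B₀) (h : Equivalent p g f) :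
    ∃ B : W →+ W →+ ZMod p, IsSymmNondegenerate B ∧ Finite W ∧
      Nonempty (TriFormEquiv (triForm B₀ g) (triForm B f)) := by
  obtain ⟨f', hf', N₁, N₂, N₃, hN⟩ := h
  have hW : Finite W := Finite.of_equiv V N₁.toEquiv
  have hg : ∀ x y, g x y = N₁.symm (f' (N₂ x) (N₃ y)) := fun x y => by
    rw [← hN, AddEquiv.symm_apply_apply]
  have hB₁ := hB₀.compHom N₁.symm
  have hadj : ∀ B : W →+ W →+ ZMod p, IsSymmNondegenerate B → ∃ N : V ≃+ W, ∀ w z,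
      B₀ (N₁.symm w) z = B w (N z) := fun B hB => by
    obtain ⟨R, hR⟩ := hB.exists_adjoint_equiv hB₀ N₁.symm
    exact ⟨R, fun w z => by rw [hB.symm, hR, hB₀.symm]⟩
  rcases hf' with rfl | rfl | ⟨B, hs, hn, ht⟩ | ⟨B, hs, hn, ht⟩ | ⟨k, ⟨B, hs, hn, ht⟩, rfl⟩ |
    ⟨k, ⟨B, hs, hn, ht⟩, rfl⟩
  · exact ⟨_, hB₁, hW, ⟨1, ![N₂, N₃, N₁], fun x => by simp [triForm, hg]⟩⟩
  · exact ⟨_, hB₁, hW, ⟨Equiv.swap 0 1, ![N₃, N₂, N₁], fun x => by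
      simp [triForm, hg, dualMul, Equiv.swap_apply_of_ne_of_ne]⟩⟩
  · obtain ⟨N, hNz⟩ := hadj B ⟨hs, hn⟩
    exact ⟨B, ⟨hs, hn⟩, hW, ⟨Equiv.swap 0 2, ![N, N₃, N₂], fun x => by
      simp [triForm, hg, Equiv.swap_apply_of_ne_of_ne, hNz, ht, hs (N₂ (x 0))]⟩⟩
  · obtain ⟨N, hNz⟩ := hadj B ⟨hs, hn⟩
    exact ⟨B, ⟨hs, hn⟩, hW, ⟨Equiv.swap 0 2 * Equiv.swap 0 1, ![N₃, N, N₂], fun x => by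
      simp [triForm, hg, Equiv.swap_apply_of_ne_of_ne, hNz, ht, dualMul, hs (N₂ (x 0))]⟩⟩
  · obtain ⟨N, hNz⟩ := hadj B ⟨hs, hn⟩
    exact ⟨B, ⟨hs, hn⟩, hW, ⟨Equiv.swap 0 1 * Equiv.swap 0 2, ![N, N₂, N₃], fun x => by
      simp [triForm, hg, Equiv.swap_apply_of_ne_of_ne, hNz, ht, dualMul, hs (N₃ (x 1))]⟩⟩
  · obtain ⟨N, hNz⟩ := hadj B ⟨hs, hn⟩
    exact ⟨B, ⟨hs, hn⟩, hW, ⟨Equiv.swap 1 2, ![N₂, N, N₃], fun x => by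
      simp [triForm, hg, Equiv.swap_apply_of_ne_of_ne, hNz, ht, dualMul, hs (N₃ (x 1))]⟩⟩

/-! ## Derivations of the trilinear form of the new family -/

/-- Conditions on the parameters which make the derivations of the new multiplication with
`τ = σ ^ 3` rigid enough to separate it from the known families. -/
structure IsSeparatingParameter (p : ℕ) {L : Type*} [Field L] (σ : RingAut L) (α η : L) :
    Prop where
  two_ne : (2 : L) ≠ 0
  alpha_ne : α ≠ 0
  eta_ne : η ≠ 0
  map_eta : σ η = η
  lt_orderOf : 9 < orderOf σ
  odd_orderOf : Odd (orderOf σ)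
  card_fixed_le : Nat.card {x // σ x = x} ≤ p ^ 2
  map_ne : ∀ d, d ≠ 0 → σ d ≠ -η * d

theorem eq_of_sum_eq_sum {M : Type*} [AddCommGroup M] {k k' : Fin 3 → M}
    (hsum : ∑ i, k i = ∑ i, k' i) {j l : Fin 3} (hjl : j ≠ l) (hj : k j = k' j)
    (hl : k l = k' l) : k = k' := by
  funext m
  by_contra hm
  refine hm (sub_eq_zero.1 ?_)
  rw [← Fintype.sum_eq_single (f := fun i => k i - k' i) m fun i hi => ?_, sum_sub_distrib, hsum,
    sub_self]
  have hmj : m ≠ j := by rintro rfl; exact hm hj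
  have hml : m ≠ l := by rintro rfl; exact hm hl
  obtain rfl | rfl : i = j ∨ i = l := by omega
  exacts [sub_eq_zero.2 hj, sub_eq_zero.2 hl]

section Field

variable {p : ℕ} {L : Type*} [Field L] {σ : RingAut L} {α η : L}

theorem pow_apply_eq_self {k : L} (hk : σ k = k) (n : ℕ) : (σ ^ n) k = k :=
  MulAction.mem_stabilizer_iff.1 (pow_mem (S := MulAction.stabilizer (RingAut L) k) hk n)

theorem pow_apply_eq_prod_mul {c u : L} (h : σ u = c * u) (n : ℕ) :
    (σ ^ n) u = (∏ i ∈ range n, (σ ^ i) c) * u := by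
  induction n with
  | zero => simp
  | succ n ih => rw [pow_succ, RingAut.mul_apply, h, map_mul, ih, prod_range_succ]; ring

theorem pow_apply_eq_pow_mul {c u : L} (hc : σ c = c) (h : σ u = c * u) (n : ℕ) :
    (σ ^ n) u = c ^ n * u := by
  rw [pow_apply_eq_prod_mul h, prod_congr rfl fun i _ => pow_apply_eq_self hc i, prod_const,
    card_range]

theorem eq_zero_of_apply_eq_neg (h2 : (2 : L) ≠ 0) {n : ℕ} (hn : Odd n) (hσ : σ ^ n = 1) {u : L}
    (hu : σ u = -u) : u = 0 := by
  have hfix := pow_apply_eq_pow_mul (c := -1) (by simp) (hu.trans (neg_one_mul u).symm) n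
  rw [hσ, RingAut.one_apply, hn.neg_one_pow] at hfix
  exact (mul_eq_zero.1 (by linear_combination hfix : 2 * u = 0)).resolve_left h2

namespace IsSeparatingParameter

theorem eq_zero_of_pow_apply_eq_neg (hA : IsSeparatingParameter p σ α η) (n : ℕ) {u : L}
    (hu : (σ ^ n) u = -u) : u = 0 :=
  eq_zero_of_apply_eq_neg hA.two_ne hA.odd_orderOf
    (by rw [← pow_mul, mul_comm, pow_mul, pow_orderOf_eq_one, one_pow]) hu

theorem eq_zero_of_map_eq_neg (hA : IsSeparatingParameter p σ α η) {u : L} (hu : σ u = -u) :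
    u = 0 :=
  hA.eq_zero_of_pow_apply_eq_neg 1 (by rwa [pow_one])

theorem pow_ne_one (hA : IsSeparatingParameter p σ α η) {n : ℕ} (hn : n ≠ 0) (hn' : n < 10) :
    σ ^ n ≠ 1 :=
  pow_ne_one_of_lt_orderOf hn (by have := hA.lt_orderOf; omega)

theorem ne_one (hA : IsSeparatingParameter p σ α η) : σ ≠ 1 := by
  simpa using hA.pow_ne_one one_ne_zero (by norm_num)

variable [Finite L]

theorem exists_pow_apply_ne (hA : IsSeparatingParameter p σ α η) (θ : L →+* L) {n : ℕ}
    (hn : n ≠ 0) (hn' : n < 10) : ∃ e, (σ ^ n) (θ e) ≠ θ e := by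
  obtain ⟨x, hx⟩ := DFunLike.ne_iff.1 (hA.pow_ne_one hn hn')
  obtain ⟨e, rfl⟩ := Finite.injective_iff_surjective.1 θ.injective x
  exact ⟨e, hx⟩

theorem ringHom_eq (hA : IsSeparatingParameter p σ α η) {θ θ' : L →+* L}
    (h : ∀ e, σ (θ e - θ' e) = θ e - θ' e) : θ = θ' := by
  rcases ringHom_eq_or_eq_of_add_eq_add hA.two_ne (θ₁ := θ) (θ₂ := (σ : L →+* L).comp θ')
    (χ₁ := θ') (χ₂ := (σ : L →+* L).comp θ) (fun e => by
      have he := h e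
      rw [map_sub] at he
      simp only [RingHom.comp_apply, RingHom.coe_coe]
      linear_combination -he) with h₁ | h₁
  · exact h₁.1
  · obtain ⟨e, he⟩ := hA.exists_pow_apply_ne θ one_ne_zero (by norm_num)
    exact absurd (DFunLike.congr_fun h₁.1 e).symm (by simpa using he)

theorem exists_add_ne (hA : IsSeparatingParameter p σ α η) (θ ψ : L →+* L) :
    ∃ e, ψ e + θ e ≠ σ (σ (θ e)) + σ (ψ e) := by
  by_contra! hadd
  rcases ringHom_eq_or_eq_of_add_eq_add hA.two_ne
    (χ₁ := (σ : L →+* L).comp ((σ : L →+* L).comp θ)) (χ₂ := (σ : L →+* L).comp ψ) hadd with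
    ⟨hψ, hθ⟩ | ⟨-, hθ⟩
  · obtain ⟨e, he⟩ := hA.exists_pow_apply_ne θ three_ne_zero (by norm_num)
    have hψe : ψ e = σ (σ (θ e)) := DFunLike.congr_fun hψ e
    have hθe : θ e = σ (ψ e) := DFunLike.congr_fun hθ e
    exact he (by rw [pow_succ', pow_two, RingAut.mul_apply, RingAut.mul_apply, ← hψe, ← hθe])
  · obtain ⟨e, he⟩ := hA.exists_pow_apply_ne θ two_ne_zero (by norm_num)
    exact he (DFunLike.congr_fun hθ e).symm

theorem coe_ringHom_ne (hA : IsSeparatingParameter p σ α η) {a b : L → L}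
    (hab : ∀ e, σ (a e - b e) = a e - b e) {ψ : L →+* L} (hψ : ∀ e, ψ e = -(a e + σ (b e)))
    (θ : L →+* L) : ⇑θ ≠ a ∧ ⇑θ ≠ b := by
  simp only [map_sub] at hab
  have hψσ : ∀ e, σ (ψ e) = -(σ (a e) + σ (σ (b e))) := fun e => by
    rw [hψ, map_neg, map_add]
  obtain ⟨e, he⟩ := hA.exists_add_ne θ ψ
  constructor
  · rintro rfl
    have habσ := congrArg σ (hab e)
    rw [map_sub, map_sub] at habσ
    exact he (by linear_combination hψ e - hψσ e - habσ)
  · rintro rfl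
    exact he (by linear_combination hψ e - hψσ e + hab e)

end IsSeparatingParameter

/-- The trace form on `L × L`. -/
noncomputable def prodTrace (p : ℕ) (L : Type*) [Field L] [Algebra (ZMod p) L] :
    L × L →+ L × L →+ ZMod p :=
  (((Algebra.trace (ZMod p) L).toAddMonoidHom.comp
    ((AddMonoidHom.id L).coprod (AddMonoidHom.id L))).compHom).comp AddMonoidHom.mul

theorem prodTrace_apply [Algebra (ZMod p) L] (x y : L × L) :
    prodTrace p L x y = Algebra.trace (ZMod p) L (x.1 * y.1 + x.2 * y.2) := rfl

theorem prodTrace_mul [Algebra (ZMod p) L] (a x y : L × L) :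
    prodTrace p L (a * x) y = prodTrace p L x (a * y) := by
  simp only [prodTrace_apply, Prod.fst_mul, Prod.snd_mul, mul_left_comm, mul_assoc]

theorem isSymmNondegenerate_prodTrace [Fact p.Prime] [Algebra (ZMod p) L] [Finite L] :
    IsSymmNondegenerate (prodTrace p L) where
  symm x y := by simp only [prodTrace_apply, mul_comm]
  nondegenerate x hx := by
    have htrace := (traceForm_nondegenerate (ZMod p) L).1
    exact Prod.ext (htrace x.1 fun y => by simpa [prodTrace_apply] using hx (y, 0))
      (htrace x.2 fun y => by simpa [prodTrace_apply] using hx (0, y))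

theorem mulLeft_eq_mulLeft {R : Type*} [NonAssocSemiring R] {a b : R} :
    AddMonoidHom.mulLeft a = AddMonoidHom.mulLeft b ↔ a = b :=
  ⟨fun h => by simpa using DFunLike.congr_fun h 1, congrArg _⟩

theorem exists_ringHom_of_conj_eq_mulLeft {R A W : Type*} [Semiring R] [Semiring A]
    [AddCommMonoid W] (N : A ≃+ W) (F : R →+* AddMonoid.End W) {u : R → A}
    (h : ∀ e x, N.symm (F e (N x)) = u e * x) : ∃ θ : R →+* A, ∀ e, u e = θ e := by
  have hu : ∀ e, u e = N.symm (F e (N 1)) := fun e => by rw [h, mul_one]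
  have map_one : u 1 = 1 := by rw [hu, map_one]; exact N.symm_apply_apply 1
  have map_mul : ∀ e e', u (e * e') = u e * u e' := fun e e' => by
    rw [← h, hu e', N.apply_symm_apply, hu, map_mul]; rfl
  have map_zero : u 0 = 0 := by rw [hu, map_zero]; exact map_zero N.symm
  have map_add : ∀ e e', u (e + e') = u e + u e' := fun e e' => by
    rw [hu, map_add, hu, hu]; exact map_add N.symm _ _
  exact ⟨⟨⟨⟨u, map_one⟩, map_mul⟩, map_zero, map_add⟩, fun _ => rfl⟩

theorem TriFormEquiv.exists_ringHom_of_conj_eq_mulLeft {R A W : Type*} [Semiring R] [Ring A]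
    [AddCommGroup W] {t : (Fin 3 → A) → ZMod p} {t' : (Fin 3 → W) → ZMod p}
    (E : TriFormEquiv t t') {D : R → Fin 3 → W →+ W} {F : Fin 3 → R →+* AddMonoid.End W}
    (hF : ∀ j, j ≠ 2 → ∀ e, D e j = F j e) {j : Fin 3} (hj : E.perm.symm j ≠ 2) {u : R → A}
    (hu : ∀ e, E.conj (D e) j = AddMonoidHom.mulLeft (u e)) : ∃ θ : R →+* A, ∀ e, u e = θ e :=
  Semifields.exists_ringHom_of_conj_eq_mulLeft (E.map (E.perm.symm j)) (F (E.perm.symm j))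
    fun e x => by
      have hx := DFunLike.congr_fun (hu e) x
      rwa [conj_apply, hF _ hj] at hx

/-- The triple of diagonal maps attached to two scalars; for `a - b` fixed by `σ` these are the
derivations of the new family. -/
def newDerivation (σ : RingAut L) (a b : L) : Fin 3 → L × L →+ L × L :=
  ![AddMonoidHom.mulLeft (a, a), AddMonoidHom.mulLeft (b, b),
    AddMonoidHom.mulLeft (-(a + σ b), -(a + (σ ^ 3) b))]

/-- The trilinear form of the new multiplication with `τ = σ ^ 3`. -/
noncomputable def newForm (p : ℕ) [Algebra (ZMod p) L] (σ : RingAut L) (α η : L) :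
    (Fin 3 → L × L) → ZMod p :=
  triForm (prodTrace p L) (newMul σ (σ ^ 3) α η)

theorem isDerivation_newMul (hη : σ η = η) {a b : L} (hab : σ (a - b) = a - b) :
    IsDerivation (newMul σ (σ ^ 3) α η) (AddMonoidHom.mulLeft (a, a))
      (AddMonoidHom.mulLeft (b, b)) (AddMonoidHom.mulLeft (a + σ b, a + (σ ^ 3) b)) := by
  intro x y
  have hab₃ := pow_apply_eq_self hab 3
  rw [map_sub] at hab hab₃
  simp only [newMul_apply (pow_apply_eq_self hη 3), twistedMul, AddMonoidHom.coe_mulLeft,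
    Prod.fst_mul, Prod.snd_mul, Prod.mk_mul_mk, map_mul, Prod.mk_add_mk, Prod.mk.injEq]
  constructor
  · linear_combination (η * σ x.2 * y.2 + α * η * σ x.1 * y.1) * hab
  · linear_combination -((σ ^ 3) x.1 * y.2) * hab₃

theorem eq_and_eq_of_newDerivation_apply_eq_zero (hA : IsSeparatingParameter p σ α η) {a b : L}
    (hab : σ (a - b) = a - b) {j : Fin 3} (hj : newDerivation σ a b j = 0) :
    σ a = a ∧ σ b = b := by
  have hsmul : ∀ {u v : L}, AddMonoidHom.mulLeft (u, v) = 0 → u = 0 ∧ v = 0 := fun h => by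
    simpa [Prod.ext_iff] using DFunLike.congr_fun h (1, 1)
  rw [map_sub] at hab
  fin_cases j
  · obtain ⟨rfl, -⟩ := hsmul hj
    exact ⟨map_zero σ, by simpa using hab⟩
  · obtain ⟨rfl, -⟩ := hsmul hj
    exact ⟨by simpa using hab, map_zero σ⟩
  · obtain ⟨h₁, h₂⟩ := hsmul hj
    rw [pow_succ', pow_two, RingAut.mul_apply, RingAut.mul_apply] at h₂
    have hσ₂ : σ (σ b) = b := σ.injective (by linear_combination h₁ - h₂)
    have hσ : σ b - b = 0 := hA.eq_zero_of_map_eq_neg (by rw [map_sub, hσ₂, neg_sub])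
    exact ⟨by linear_combination hab + hσ, sub_eq_zero.1 hσ⟩

variable [Fact p.Prime] [Algebra (ZMod p) L] [Finite L]

theorem mem_derivations_newForm (hA : IsSeparatingParameter p σ α η)
    {D : Fin 3 → L × L →+ L × L} :
    D ∈ derivations (newForm p σ α η) ↔
      ∃ a b, σ (a - b) = a - b ∧ D = newDerivation σ a b := by
  have hB := isSymmNondegenerate_prodTrace (p := p) (L := L)
  constructor
  · intro h
    obtain ⟨C, hC, hD⟩ := exists_isDerivation_of_mem_derivations hB h
    obtain ⟨a, b, hab, h₀, h₁, h₂⟩ := scalar_of_isDerivation_newMul hA.alpha_ne hA.eta_ne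
      hA.map_eta (by linarith [hA.lt_orderOf]) (fun _ => hA.eq_zero_of_map_eq_neg) hD
    have hC' : ∀ x, C x = (a + σ b, a + (σ ^ 3) b) * x := h₂
    refine ⟨a, b, hab, funext fun j => ?_⟩
    fin_cases j
    · exact AddMonoidHom.ext h₀
    · exact AddMonoidHom.ext h₁
    · ext1 y
      have hD₂ : -D 2 y = (a + σ b, a + (σ ^ 3) b) * y := hB.ext fun x => by
        rw [hB.symm, hB.symm _ x, ← prodTrace_mul, ← hC', hC]
      change D 2 y = -(a + σ b, a + (σ ^ 3) b) * y
      rw [neg_mul, ← hD₂, neg_neg]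
  · rintro ⟨a, b, hab, rfl⟩
    refine mem_derivations_triForm.2 fun x y z => ?_
    change _ + _ + prodTrace p L _ (-(a + σ b, a + (σ ^ 3) b) * z) = 0
    rw [← AddMonoidHom.add_apply, ← map_add, neg_mul, map_neg, ← prodTrace_mul,
      add_neg_eq_zero]
    exact congrArg (prodTrace p L · z) (isDerivation_newMul hA.map_eta hab x y).symm

theorem scalar_mem_derivations_newForm (hA : IsSeparatingParameter p σ α η) {k : Fin 3 → L}
    (hk : ∀ i, σ (k i) = k i) (hsum : ∑ i, k i = 0) :
    (fun i => AddMonoidHom.mulLeft (k i, k i)) ∈ derivations (newForm p σ α η) := by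
  refine (mem_derivations_newForm hA).2 ⟨k 0, k 1, by rw [map_sub, hk, hk], funext fun i => ?_⟩
  rw [Fin.sum_univ_three] at hsum
  fin_cases i
  · rfl
  · rfl
  · change AddMonoidHom.mulLeft (k 2, k 2) =
      AddMonoidHom.mulLeft (-(k 0 + σ (k 1)), -(k 0 + (σ ^ 3) (k 1)))
    rw [pow_apply_eq_self (hk 1), hk 1, eq_neg_of_add_eq_zero_right hsum]

theorem exists_scalar_of_apply_eq_zero (hA : IsSeparatingParameter p σ α η)
    {D : Fin 3 → L × L →+ L × L} (hD : D ∈ derivations (newForm p σ α η)) {j : Fin 3}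
    (hj : D j = 0) : ∃ k : Fin 3 → L, (∀ i, σ (k i) = k i) ∧ ∑ i, k i = 0 ∧
      ∀ i, D i = AddMonoidHom.mulLeft (k i, k i) := by
  obtain ⟨a, b, hab, rfl⟩ := (mem_derivations_newForm hA).1 hD
  obtain ⟨ha, hb⟩ := eq_and_eq_of_newDerivation_apply_eq_zero hA hab hj
  refine ⟨![a, b, -(a + b)], fun i => ?_, by simp [Fin.sum_univ_three], fun i => ?_⟩
  · fin_cases i
    exacts [ha, hb, by simp [ha, hb]]
  · fin_cases i
    exacts [rfl, rfl, by simp [newDerivation, hb, pow_apply_eq_self hb]]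

theorem exists_mem_derivations_of_apply_eq_zero {W : Type*} [AddCommGroup W]
    {t : (Fin 3 → W) → ZMod p} (hA : IsSeparatingParameter p σ α η)
    (E : TriFormEquiv (newForm p σ α η) t) {D : Fin 3 → W →+ W} (hD : D ∈ derivations t)
    {i j l : Fin 3} (hj : D j = 0) (hil : i ≠ l) :
    ∃ D' ∈ derivations t, D' i = D i ∧ D' l = 0 := by
  obtain ⟨k, hk, -, hkD⟩ := exists_scalar_of_apply_eq_zero hA (E.conj_mem hD) (j := E.perm j)
    (E.conj_eq_zero (by rwa [Equiv.symm_apply_apply]))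
  obtain ⟨m, hmi, hml⟩ : ∃ m, m ≠ E.perm i ∧ m ≠ E.perm l :=
    (by decide : ∀ i l : Fin 3, ∃ m, m ≠ i ∧ m ≠ l) _ _
  let c := k (E.perm i)
  let q : Fin 3 → L := Pi.single (E.perm i) c - Pi.single m c
  have hq : ∀ n, σ (q n) = q n := fun n => by
    simp only [q, c, Pi.sub_apply, Pi.single_apply, map_sub, apply_ite σ, hk, map_zero]
  have hmem := E.symm.conj_mem (scalar_mem_derivations_newForm (p := p) hA hq (by simp [q]))
  refine ⟨_, hmem, ?_, E.symm.conj_eq_zero ?_⟩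
  · rw [← congrFun (E.conj_symm_conj D) i]
    refine E.symm.conj_congr ?_
    change AddMonoidHom.mulLeft (q (E.perm i), q (E.perm i)) = E.conj D (E.perm i)
    simp [hkD, q, c, hmi.symm]
  · change AddMonoidHom.mulLeft (q (E.perm l), q (E.perm l)) = 0
    have hq₀ : q (E.perm l) = 0 := by simp [q, hml.symm, hil.symm]
    rw [hq₀]
    exact AddMonoidHom.ext zero_mul

theorem card_le_of_apply_eq_zero {W H : Type*} [AddCommGroup W] {t : (Fin 3 → W) → ZMod p}
    (hA : IsSeparatingParameter p σ α η) (E : TriFormEquiv (newForm p σ α η) t)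
    {D : H → Fin 3 → W →+ W} (hD : ∀ i, D i ∈ derivations t) {j : Fin 3} (hj : ∀ i, D i j = 0)
    (hinj : Function.Injective D) : Nat.card H ≤ p ^ 2 := by
  have hj' : ∀ i, E.conj (D i) (E.perm j) = 0 := fun i =>
    E.conj_eq_zero (by rw [Equiv.symm_apply_apply, hj])
  choose k hk hsum hkD using fun i => exists_scalar_of_apply_eq_zero hA (E.conj_mem (hD i)) (hj' i)
  have hkj : ∀ i, k i (E.perm j) = 0 := fun i =>
    (Prod.ext_iff.1 (mulLeft_eq_mulLeft.1 ((hkD i _).symm.trans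
      ((hj' i).trans (AddMonoidHom.ext zero_mul).symm)))).1
  obtain ⟨l, hl⟩ := exists_ne (E.perm j)
  refine (Nat.card_le_card_of_injective (fun i => (⟨k i l, hk i l⟩ : {x // σ x = x}))
    fun i i' hii' => hinj (E.conj_injective (funext fun m => ?_))).trans hA.card_fixed_le
  rw [hkD, hkD, eq_of_sum_eq_sum ((hsum i).trans (hsum i').symm) hl.symm
    ((hkj i).trans (hkj i').symm) (congrArg Subtype.val hii')]

theorem exists_ringHom_conj_two {W : Type*} [AddCommGroup W] {t : (Fin 3 → W) → ZMod p}
    (hA : IsSeparatingParameter p σ α η) (E : TriFormEquiv (newForm p σ α η) t)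
    {D : L → Fin 3 → W →+ W} (hD : ∀ e, D e ∈ derivations t) {F : Fin 3 → L →+* AddMonoid.End W}
    (hF : ∀ j, j ≠ 2 → ∀ e, D e j = F j e) :
    E.perm.symm 2 = 2 ∧ ∃ θ : L →+* L, ∀ e, E.conj (D e) 2 =
      AddMonoidHom.mulLeft (-(θ e + σ (θ e)), -(θ e + (σ ^ 3) (θ e))) := by
  choose a b hab hconj using fun e => (mem_derivations_newForm hA).1 (E.conj_mem (hD e))
  have h₀ : E.perm.symm 0 ≠ 2 → ∃ θ : L →+* L, a = θ := fun h => by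
    obtain ⟨θ, hθ⟩ := E.exists_ringHom_of_conj_eq_mulLeft hF h fun e => congrFun (hconj e) 0
    exact ⟨(RingHom.fst L L).comp θ, funext fun e => congrArg Prod.fst (hθ e)⟩
  have h₁ : E.perm.symm 1 ≠ 2 → ∃ θ : L →+* L, b = θ := fun h => by
    obtain ⟨θ, hθ⟩ := E.exists_ringHom_of_conj_eq_mulLeft hF h fun e => congrFun (hconj e) 1
    exact ⟨(RingHom.fst L L).comp θ, funext fun e => congrArg Prod.fst (hθ e)⟩
  have hperm : E.perm.symm 2 = 2 := by
    by_contra h₂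
    obtain ⟨ψ, hψ⟩ := E.exists_ringHom_of_conj_eq_mulLeft hF h₂ fun e => congrFun (hconj e) 2
    have hne := hA.coe_ringHom_ne (ψ := (RingHom.fst L L).comp ψ) hab fun e =>
      (congrArg Prod.fst (hψ e)).symm
    have h : E.perm.symm 0 ≠ 2 ∨ E.perm.symm 1 ≠ 2 := by
      by_contra! h
      exact absurd (E.perm.symm.injective (h.1.trans h.2.symm)) (by decide)
    rcases h with h | h
    · obtain ⟨θ, hθ⟩ := h₀ h
      exact (hne θ).1 hθ.symm
    · obtain ⟨θ, hθ⟩ := h₁ h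
      exact (hne θ).2 hθ.symm
  have hne : ∀ {j}, j ≠ 2 → E.perm.symm j ≠ 2 := fun hj h =>
    hj (E.perm.symm.injective (h.trans hperm.symm))
  obtain ⟨θ, rfl⟩ := h₀ (hne (by decide))
  obtain ⟨θ', rfl⟩ := h₁ (hne (by decide))
  obtain rfl := hA.ringHom_eq hab
  exact ⟨hperm, θ, fun e => by rw [hconj]; rfl⟩

/-! ## Multiplications equivalent to the new one -/

section Equivalent

variable {W H : Type*} [AddCommGroup W] {f : W → W → W} {X Y Z : W →+ W}

theorem card_le_of_isDerivation (hA : IsSeparatingParameter p σ α η)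
    (hE : Equivalent p (newMul σ (σ ^ 3) α η) f) {X Y Z : H → W →+ W}
    (h : ∀ i, IsDerivation f (X i) (Y i) (Z i)) (hinj : Function.Injective fun i => (X i, Y i)) :
    Nat.card H ≤ p ^ 2 * Nat.card L := by
  obtain ⟨B, hB, _, ⟨E⟩⟩ := hE.exists_triFormEquiv isSymmNondegenerate_prodTrace
  choose R _ hD using fun i => (h i).exists_mem_derivations hB
  choose a b hab hconj using fun i => (mem_derivations_newForm hA).1 (E.conj_mem (hD i))
  refine le_trans ?_ (Nat.mul_le_mul_right (Nat.card L) hA.card_fixed_le)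
  rw [← Nat.card_prod]
  refine Nat.card_le_card_of_injective
    (fun i => ((⟨a i - b i, hab i⟩, a i) : {x // σ x = x} × L)) fun i j hij => hinj ?_
  obtain ⟨hsub, ha⟩ : a i - b i = a j - b j ∧ a i = a j := by simpa using hij
  have hb : b i = b j := by linear_combination ha - hsub
  have hD_eq := E.conj_injective ((hconj i).trans (by rw [ha, hb, hconj]))
  exact Prod.ext (congrFun hD_eq 0) (congrFun hD_eq 1)

theorem card_le_of_isDerivation_left (hA : IsSeparatingParameter p σ α η)
    (hE : Equivalent p (newMul σ (σ ^ 3) α η) f) {X Z : H → W →+ W}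
    (h : ∀ i, IsDerivation f (X i) 0 (Z i)) (hinj : Function.Injective X) :
    Nat.card H ≤ p ^ 2 := by
  obtain ⟨B, hB, _, ⟨E⟩⟩ := hE.exists_triFormEquiv isSymmNondegenerate_prodTrace
  choose R _ hD using fun i => (h i).exists_mem_derivations hB
  exact card_le_of_apply_eq_zero hA E hD (j := 1) (fun _ => rfl)
    fun i j hij => hinj (congrFun hij 0)

theorem card_le_of_isDerivation_right (hA : IsSeparatingParameter p σ α η)
    (hE : Equivalent p (newMul σ (σ ^ 3) α η) f) {Y Z : H → W →+ W}
    (h : ∀ i, IsDerivation f 0 (Y i) (Z i)) (hinj : Function.Injective Y) :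
    Nat.card H ≤ p ^ 2 := by
  obtain ⟨B, hB, _, ⟨E⟩⟩ := hE.exists_triFormEquiv isSymmNondegenerate_prodTrace
  choose R _ hD using fun i => (h i).exists_mem_derivations hB
  exact card_le_of_apply_eq_zero hA E hD (j := 0) (fun _ => rfl)
    fun i j hij => hinj (congrFun hij 1)

theorem card_le_of_isDerivation_middle (hA : IsSeparatingParameter p σ α η)
    (hE : Equivalent p (newMul σ (σ ^ 3) α η) f) {X Y : H → W →+ W}
    (h : ∀ i, IsDerivation f (X i) (Y i) 0) (hinj : Function.Injective X) :
    Nat.card H ≤ p ^ 2 := by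
  obtain ⟨B, -, -, ⟨E⟩⟩ := hE.exists_triFormEquiv isSymmNondegenerate_prodTrace
  have hD : ∀ i, ![X i, Y i, 0] ∈ derivations (triForm B f) := fun i =>
    mem_derivations_triForm.2 fun x y z => by
      change B (f (X i x) y) z + B (f x (Y i y)) z + B (f x y) 0 = 0
      rw [← AddMonoidHom.add_apply, ← map_add, ← h i x y, map_zero, AddMonoidHom.zero_apply,
        map_zero, AddMonoidHom.zero_apply, add_zero]
  exact card_le_of_apply_eq_zero hA E hD (j := 2) (fun _ => rfl)
    fun i j hij => hinj (congrFun hij 0)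

theorem exists_middle_of_left (hA : IsSeparatingParameter p σ α η)
    (hE : Equivalent p (newMul σ (σ ^ 3) α η) f) (h : IsDerivation f X 0 Z) :
    ∃ Y, IsDerivation f X Y 0 := by
  obtain ⟨B, hB, _, ⟨E⟩⟩ := hE.exists_triFormEquiv isSymmNondegenerate_prodTrace
  obtain ⟨R, -, hXY⟩ := h.exists_mem_derivations hB
  obtain ⟨D, hD, h₀ : D 0 = X, h₂⟩ := exists_mem_derivations_of_apply_eq_zero hA E hXY
    (i := 0) (j := 1) (l := 2) rfl (by decide)
  subst h₀
  exact ⟨D 1, isDerivation_of_mem_derivations hB hD h₂⟩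

theorem exists_middle_of_right (hA : IsSeparatingParameter p σ α η)
    (hE : Equivalent p (newMul σ (σ ^ 3) α η) f) (h : IsDerivation f 0 Y Z) :
    ∃ X, IsDerivation f X Y 0 := by
  obtain ⟨B, hB, _, ⟨E⟩⟩ := hE.exists_triFormEquiv isSymmNondegenerate_prodTrace
  obtain ⟨R, -, hXY⟩ := h.exists_mem_derivations hB
  obtain ⟨D, hD, h₁ : D 1 = Y, h₂⟩ := exists_mem_derivations_of_apply_eq_zero hA E hXY
    (i := 1) (j := 0) (l := 2) rfl (by decide)
  subst h₁
  exact ⟨D 0, isDerivation_of_mem_derivations hB hD h₂⟩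

end Equivalent

end Field

/-! ## The weights of a torus of derivations -/

section Torus

theorem exists_ringHom_of_map_mul {R M : Type*} [CommRing R] [Field M] {f : R →+ M}
    (hf₁ : f 1 ≠ 0) (h : ∀ x, ∃ c, ∀ y, f (x * y) = c * f y) :
    ∃ χ : R →+* M, ∀ z, f z = χ z * f 1 := by
  choose c hc using h
  have hf : ∀ z, f z = c z * f 1 := fun z => by rw [← hc, mul_one]
  have map_one : c 1 = 1 := mul_right_cancel₀ hf₁ (by rw [← hf, one_mul])
  have map_mul : ∀ x y, c (x * y) = c x * c y := fun x y =>
    mul_right_cancel₀ hf₁ (by rw [← hf, hc, hf, mul_assoc])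
  have map_zero : c 0 = 0 := mul_right_cancel₀ hf₁ (by rw [← hf, f.map_zero, zero_mul])
  have map_add : ∀ x y, c (x + y) = c x + c y := fun x y =>
    mul_right_cancel₀ hf₁ (by rw [← hf, f.map_add, hf, hf y, add_mul])
  exact ⟨⟨⟨⟨c, map_one⟩, map_mul⟩, map_zero, map_add⟩, hf⟩

variable {L : Type*} [Field L] [Finite L]

theorem surjective_add_of_map_mul {ρ μ ν : RingAut L} (hρ : ∀ u, ρ u = -u → u = 0) {θ : L →+* L}
    {f : L →+ L} (hf₁ : f 1 ≠ 0) (h : ∀ e z, f ((μ e + ν e) * z) = (θ e + ρ (θ e)) * f z) :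
    Function.Surjective fun e => μ e + ν e := by
  refine Finite.injective_iff_surjective.1 <| (injective_iff_map_eq_zero
    ((μ : L →+ L) + (ν : L →+ L))).2 fun e he => ?_
  have he₁ := h e 1
  rw [show μ e + ν e = 0 from he, zero_mul, map_zero] at he₁
  have hθ := (mul_eq_zero.1 he₁.symm).resolve_right hf₁
  exact (map_eq_zero θ).1 (hρ _ (by linear_combination hθ))

theorem eq_mul_or_eq_mul_of_map_mul (h₂ : (2 : L) ≠ 0) {ρ μ ν : RingAut L}
    (hρ : ∀ u, ρ u = -u → u = 0) {θ : L →+* L} {f : L →+ L} (hf₁ : f 1 ≠ 0)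
    (h : ∀ e z, f ((μ e + ν e) * z) = (θ e + ρ (θ e)) * f z) : ν = ρ * μ ∨ μ = ρ * ν := by
  obtain ⟨χ, hχ⟩ := exists_ringHom_of_map_mul hf₁ fun x => by
    obtain ⟨e, rfl⟩ := surjective_add_of_map_mul hρ hf₁ h x
    exact ⟨_, h e⟩
  have hsum : ∀ e, χ.comp (μ : L →+* L) e + χ.comp (ν : L →+* L) e =
      θ e + (ρ : L →+* L).comp θ e := fun e => mul_right_cancel₀ hf₁ <| by
    simpa [hχ (μ e + ν e)] using h e 1
  have hcomm : ∀ z, χ (ρ z) = ρ (χ z) :=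
    let χ' : RingAut L := RingEquiv.ofBijective χ (Finite.injective_iff_bijective.1 χ.injective)
    DFunLike.congr_fun (ringAut_mul_comm χ' ρ)
  rcases ringHom_eq_or_eq_of_add_eq_add h₂ hsum with ⟨hμ, hν⟩ | ⟨hμ, hν⟩
  · refine .inl (RingEquiv.ext fun e => χ.injective ?_)
    rw [RingAut.mul_apply, hcomm]
    exact (DFunLike.congr_fun hν e).trans (congrArg ρ (DFunLike.congr_fun hμ e).symm)
  · refine .inr (RingEquiv.ext fun e => χ.injective ?_)
    rw [RingAut.mul_apply, hcomm]
    exact (DFunLike.congr_fun hμ e).trans (congrArg ρ (DFunLike.congr_fun hν e).symm)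

variable {p : ℕ} [Fact p.Prime] [Algebra (ZMod p) L] {σ : RingAut L} {α η : L}

theorem exists_intertwining_equiv {W : Type*} [AddCommGroup W] {f : W → W → W}
    (hA : IsSeparatingParameter p σ α η) (hE : Equivalent p (newMul σ (σ ^ 3) α η) f)
    {F G : L →+* AddMonoid.End W} {Z : L → W →+ W} (h : ∀ e, IsDerivation f (F e) (G e) (Z e)) :
    ∃ θ : L →+* L, ∃ Q : W ≃+ L × L,
      ∀ e w, Q (Z e w) = (θ e + σ (θ e), θ e + (σ ^ 3) (θ e)) * Q w := by
  have hB₀ := isSymmNondegenerate_prodTrace (p := p) (L := L)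
  obtain ⟨B, hB, _, ⟨E : TriFormEquiv (newForm p σ α η) (triForm B f)⟩⟩ :=
    hE.exists_triFormEquiv hB₀
  choose R hR hD using fun e => (h e).exists_mem_derivations hB
  obtain ⟨hperm, θ, hθ⟩ := exists_ringHom_conj_two hA E hD (F := ![F, G, F]) fun j hj e => by
    fin_cases j
    exacts [rfl, rfl, absurd rfl hj]
  obtain ⟨Q, hQ⟩ := hB₀.exists_adjoint_equiv hB (E.map 2)
  refine ⟨θ, Q, fun e w => hB₀.ext fun v => ?_⟩
  have hRθ : R e (E.map 2 v) = E.map 2 ((θ e + σ (θ e), θ e + (σ ^ 3) (θ e)) * v) := by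
    have hv := DFunLike.congr_fun (hθ e) v
    rw [TriFormEquiv.conj_apply, hperm, AddEquiv.symm_apply_eq] at hv
    change -R e (E.map 2 v) = E.map 2 (-(θ e + σ (θ e), θ e + (σ ^ 3) (θ e)) * v) at hv
    rwa [neg_mul, map_neg, neg_inj] at hv
  rw [hQ, prodTrace_mul, hQ, ← hRθ, hB.symm, ← hR, hB.symm]

theorem eq_mul_or_eq_mul_of_isDerivation {f : L × L → L × L → L × L}
    (hA : IsSeparatingParameter p σ α η) (hE : Equivalent p (newMul σ (σ ^ 3) α η) f)
    {F G : L →+* AddMonoid.End (L × L)} {μ₁ ν₁ μ₂ ν₂ : RingAut L}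
    (h : ∀ e, IsDerivation f (F e) (G e) (AddMonoidHom.mulLeft (μ₁ e + ν₁ e, μ₂ e + ν₂ e))) :
    (∃ ρ, (ρ = σ ∨ ρ = σ ^ 3) ∧ (ν₁ = ρ * μ₁ ∨ μ₁ = ρ * ν₁)) ∧
      ∃ ρ, (ρ = σ ∨ ρ = σ ^ 3) ∧ (ν₂ = ρ * μ₂ ∨ μ₂ = ρ * ν₂) := by
  obtain ⟨θ, Q, hQ⟩ := exists_intertwining_equiv hA hE h
  have weights : ∀ (ι : L →+ L × L) (μ ν : RingAut L), ι 1 ≠ 0 →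
      (∀ e z, ι ((μ e + ν e) * z) = (μ₁ e + ν₁ e, μ₂ e + ν₂ e) * ι z) →
      ∃ ρ, (ρ = σ ∨ ρ = σ ^ 3) ∧ (ν = ρ * μ ∨ μ = ρ * ν) := by
    intro ι μ ν hι hιe
    have hιQ : ∀ e z, Q (ι ((μ e + ν e) * z)) =
        (θ e + σ (θ e), θ e + (σ ^ 3) (θ e)) * Q (ι z) := fun e z => by
      rw [hιe]
      exact hQ e _
    by_cases h₁ : (Q (ι 1)).1 = 0
    · have h₂ : (Q (ι 1)).2 ≠ 0 := fun h₂ =>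
        hι ((map_eq_zero_iff Q Q.injective).1 (Prod.ext h₁ h₂))
      exact ⟨σ ^ 3, .inr rfl, eq_mul_or_eq_mul_of_map_mul hA.two_ne
        (fun _ => hA.eq_zero_of_pow_apply_eq_neg 3)
        (f := (AddMonoidHom.snd L L).comp ((Q : L × L →+ L × L).comp ι)) h₂
        fun e z => congrArg Prod.snd (hιQ e z)⟩
    · exact ⟨σ, .inl rfl, eq_mul_or_eq_mul_of_map_mul hA.two_ne
        (fun _ => hA.eq_zero_of_map_eq_neg)
        (f := (AddMonoidHom.fst L L).comp ((Q : L × L →+ L × L).comp ι)) h₁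
        fun e z => congrArg Prod.fst (hιQ e z)⟩
  exact ⟨weights (AddMonoidHom.inl L L) _ _ (by simp) fun e z => by simp,
    weights (AddMonoidHom.inr L L) _ _ (by simp) fun e z => by simp⟩

end Torus

/-! ## Symmetries of the new multiplication -/

section Symmetry

variable {p : ℕ} {L : Type*} [Field L] [Finite L] {σ : RingAut L} {α η : L}

theorem IsSeparatingParameter.eq_of_add_eq_add (hA : IsSeparatingParameter p σ α η)
    {χ θ θ' : L →+* L} (h₁ : ∀ e, χ e + σ (χ e) = θ e + σ (θ' e))
    (h₃ : ∀ e, χ e + (σ ^ 3) (χ e) = θ e + (σ ^ 3) (θ' e)) : χ = θ := by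
  rcases ringHom_eq_or_eq_of_add_eq_add hA.two_ne (θ₂ := (σ : L →+* L).comp χ)
    (χ₂ := (σ : L →+* L).comp θ') h₁ with ⟨h, -⟩ | ⟨-, hσ⟩
  · exact h
  rcases ringHom_eq_or_eq_of_add_eq_add hA.two_ne (θ₂ := ((σ ^ 3 : RingAut L) : L →+* L).comp χ)
    (χ₂ := ((σ ^ 3 : RingAut L) : L →+* L).comp θ') h₃ with ⟨h, -⟩ | ⟨-, hσ₃⟩
  · exact h
  obtain ⟨e, he⟩ := hA.exists_pow_apply_ne χ two_ne_zero (by norm_num)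
  refine absurd (σ.injective ?_) he
  rw [← RingAut.mul_apply, ← pow_succ']
  exact DFunLike.congr_fun (hσ₃.trans hσ.symm) e

theorem map_smul_of_newMul_eq (hA : IsSeparatingParameter p σ α η) {P : L × L ≃+ L × L}
    (h : ∀ x y, newMul σ (σ ^ 3) α η x y = newMul σ (σ ^ 3) α η (P.symm y) (P x)) (e : L)
    (x : L × L) : P (e • x) = e • P x := by
  let scalar := Module.toAddMonoidEnd L (L × L)
  let X (e : L) : L × L →+ L × L := (P.symm : L × L →+ L × L).comp ((scalar e).comp P)
  let Y (e : L) : L × L →+ L × L := (P : L × L →+ L × L).comp ((scalar e).comp P.symm)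
  have hder : ∀ e, IsDerivation (newMul σ (σ ^ 3) α η) (X e) (Y e)
      (AddMonoidHom.mulLeft (e + σ e, e + (σ ^ 3) e)) := fun e x y => by
    have hx : P (X e x) = scalar e (P x) := P.apply_symm_apply _
    have hy : P.symm (Y e y) = scalar e (P.symm y) := P.symm_apply_apply _
    rw [h x y, h (X e x), h x (Y e y), hx, hy]
    exact (isDerivation_newMul hA.map_eta (by rw [sub_self, map_zero]) _ _).trans (add_comm _ _)
  choose a b _ ha hb hab using fun e => scalar_of_isDerivation_newMul hA.alpha_ne hA.eta_ne
    hA.map_eta (by linarith [hA.lt_orderOf]) (fun _ => hA.eq_zero_of_map_eq_neg) (hder e)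
  obtain ⟨θ, hθ⟩ := exists_ringHom_of_conj_eq_mulLeft P scalar (u := fun e => (a e, a e)) ha
  obtain ⟨θ', hθ'⟩ := exists_ringHom_of_conj_eq_mulLeft P.symm scalar (u := fun e => (b e, b e)) hb
  have haθ : ∀ e, a e = (RingHom.fst L L).comp θ e := fun e => congrArg Prod.fst (hθ e)
  have hbθ : ∀ e, b e = (RingHom.fst L L).comp θ' e := fun e => congrArg Prod.fst (hθ' e)
  have hsum : ∀ e, (e + σ e, e + (σ ^ 3) e) = (a e + σ (b e), a e + (σ ^ 3) (b e)) := fun e => by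
    simpa using hab e (1, 1)
  have hid : RingHom.id L = (RingHom.fst L L).comp θ := hA.eq_of_add_eq_add
    (θ' := (RingHom.fst L L).comp θ')
    (fun e => by rw [← haθ, ← hbθ]; exact congrArg Prod.fst (hsum e))
    (fun e => by rw [← haθ, ← hbθ]; exact congrArg Prod.snd (hsum e))
  have hae : a e = e := (haθ e).trans (DFunLike.congr_fun hid e).symm
  have hPe : P.symm (e • P x) = a e • x := ha e x
  rw [← hae, ← hPe, hae, P.apply_symm_apply]

theorem not_forall_newMul_eq (hA : IsSeparatingParameter p σ α η) (P : L × L ≃+ L × L) :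
    ¬ ∀ x y, newMul σ (σ ^ 3) α η x y = newMul σ (σ ^ 3) α η (P.symm y) (P x) := fun h => by
  have hsymm : ∀ x y, newMul σ (σ ^ 3) α η x (P y) = newMul σ (σ ^ 3) α η y (P x) := fun x y => by
    rw [h x (P y), P.symm_apply_apply]
  simp only [newMul_apply (pow_apply_eq_self hA.map_eta 3), twistedMul] at hsymm
  have hP₀ : ∀ e, P (e, 0) = e • P (1, 0) := fun e => by
    simpa using map_smul_of_newMul_eq hA h e (1, 0)
  have hP₁ : ∀ e, P (0, e) = e • P (0, 1) := fun e => by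
    simpa using map_smul_of_newMul_eq hA h e (0, 1)
  obtain ⟨z, hz⟩ := DFunLike.ne_iff.1 hA.ne_one
  obtain ⟨w, hw⟩ := DFunLike.ne_iff.1 (hA.pow_ne_one three_ne_zero (by norm_num))
  have h₀₂ : (P (1, 0)).2 = 0 := by
    have hw₀ := congrArg Prod.snd (hsymm (1, 0) (w, 0))
    simp only [hP₀ w, Prod.smul_snd, smul_eq_mul, map_one, one_mul, zero_mul, add_zero] at hw₀
    exact (mul_eq_zero.1 (by linear_combination -hw₀ :
      ((σ ^ 3) w - w) * (P (1, 0)).2 = 0)).resolve_left (sub_ne_zero.2 hw)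
  have h₁₂ : (P (0, 1)).2 = 0 := by
    have hz₁ := congrArg Prod.fst (hsymm (0, 1) (0, z))
    simp only [hP₁ z, Prod.smul_fst, Prod.smul_snd, smul_eq_mul, map_one, map_zero, map_mul,
      one_mul, mul_one, zero_mul, mul_zero, sub_zero, add_zero] at hz₁
    have hmul : (σ (P (0, 1)).2 + η * (P (0, 1)).2) * (σ z - z) = 0 := by linear_combination hz₁
    have hσ := (mul_eq_zero.1 hmul).resolve_right (sub_ne_zero.2 hz)
    by_contra hne
    exact hA.map_ne _ hne (by linear_combination hσ)
  have h₀₁ : (P (1, 0)).1 = 0 := by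
    have h₁₀ := congrArg Prod.snd (hsymm (1, 0) (0, 1))
    exact (map_eq_zero (σ ^ 3)).1 (by simpa [h₁₂] using h₁₀.symm)
  simpa using (map_eq_zero_iff P P.injective).1 (Prod.ext h₀₁ h₀₂ : P (1, 0) = 0)

variable [Fact p.Prime] [Algebra (ZMod p) L] {W : Type*} [AddCommGroup W] {f : W → W → W}

theorem not_commutative (hA : IsSeparatingParameter p σ α η)
    (hE : Equivalent p (newMul σ (σ ^ 3) α η) f) : ¬ ∀ x y, f x y = f y x := fun hf => by
  have hB₀ := isSymmNondegenerate_prodTrace (p := p) (L := L)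
  obtain ⟨B, -, -, ⟨E : TriFormEquiv (newForm p σ α η) (triForm B f)⟩⟩ :=
    hE.exists_triFormEquiv hB₀
  let S : TriFormEquiv (triForm B f) (triForm B f) := ⟨Equiv.swap 0 1, fun _ => .refl W, fun x => by
    simp [triForm, hf (x 0), Equiv.swap_apply_of_ne_of_ne]⟩
  let scalar := Module.toAddMonoidEnd L (L × L)
  obtain ⟨hperm, -⟩ := exists_ringHom_conj_two hA (E.trans (S.trans E.symm))
    (D := fun e => newDerivation σ e e)
    (fun e => (mem_derivations_newForm hA).2 ⟨e, e, by rw [sub_self, map_zero], rfl⟩)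
    (F := fun _ => scalar) fun j hj e => by
      fin_cases j
      exacts [rfl, rfl, absurd rfl hj]
  have hcases : ∀ π : Equiv.Perm (Fin 3), π (Equiv.swap 0 1 (π.symm 2)) = 2 →
      (π 0 = 0 ∧ π 1 = 1 ∧ π 2 = 2) ∨ (π 0 = 1 ∧ π 1 = 0 ∧ π 2 = 2) := by decide
  have hform : ∀ x y z, prodTrace p L (newMul σ (σ ^ 3) α η x y) z =
      B (f (E.map 0 (![x, y, z] (E.perm 0))) (E.map 1 (![x, y, z] (E.perm 1))))
        (E.map 2 (![x, y, z] (E.perm 2))) := fun x y z => E.apply_eq ![x, y, z]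
  rcases hcases E.perm hperm with ⟨h₀, h₁, h₂⟩ | ⟨h₀, h₁, h₂⟩
  · refine not_forall_newMul_eq hA ((E.map 0).trans (E.map 1).symm) fun x y => hB₀.ext fun z => ?_
    rw [hform, hform, h₀, h₁, h₂, hf]
    simp
  · refine not_forall_newMul_eq hA ((E.map 1).trans (E.map 0).symm) fun x y => hB₀.ext fun z => ?_
    rw [hform, hform, h₀, h₁, h₂, hf]
    simp

end Symmetry

/-! ## Families with many derivations or large nuclei -/

namespace IsPresemifield

variable {V : Type*} [AddCommGroup V] {f : V → V → V}

theorem mul_zero (hf : IsPresemifield f) (x : V) : f x 0 = 0 := by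
  simpa using hf.mul_add x 0 0

theorem zero_mul (hf : IsPresemifield f) (y : V) : f 0 y = 0 := by
  simpa using hf.add_mul 0 0 y

theorem mul_neg (hf : IsPresemifield f) (x y : V) : f x (-y) = -f x y := by
  rw [eq_neg_iff_add_eq_zero, ← hf.mul_add, neg_add_cancel, hf.mul_zero]

theorem neg_mul (hf : IsPresemifield f) (x y : V) : f (-x) y = -f x y := by
  rw [eq_neg_iff_add_eq_zero, ← hf.add_mul, neg_add_cancel, hf.zero_mul]

/-- Left multiplication by `x` as an additive map. -/
def mulLeft (hf : IsPresemifield f) (x : V) : V →+ V :=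
  AddMonoidHom.mk' (f x) (hf.mul_add x)

/-- Right multiplication by `y` as an additive map. -/
def mulRight (hf : IsPresemifield f) (y : V) : V →+ V :=
  AddMonoidHom.mk' (f · y) fun x z => hf.add_mul x z y

theorem isDerivation_left (hf : IsPresemifield f) {X Z : V →+ V}
    (h : ∀ x y, Z (f x y) = f (X x) y) : IsDerivation f X 0 Z := fun x y => by
  rw [h, AddMonoidHom.zero_apply, hf.mul_zero, add_zero]

theorem isDerivation_right (hf : IsPresemifield f) {Y Z : V →+ V}
    (h : ∀ x y, Z (f x y) = f x (Y y)) : IsDerivation f 0 Y Z := fun x y => by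
  rw [h, AddMonoidHom.zero_apply, hf.zero_mul, zero_add]

end IsPresemifield

theorem card_le_card_ker_mul {M N : Type*} [AddGroup M] [AddGroup N] [Finite N] (φ : M →+ N) :
    Nat.card M ≤ Nat.card φ.ker * Nat.card N := by
  rw [← φ.ker.card_mul_index, AddSubgroup.index_ker]
  exact Nat.mul_le_mul_left _ (Nat.card_le_card_of_injective _ Subtype.val_injective)

section Families

variable {p : ℕ} {L : Type*} [Field L] {σ : RingAut L} {α η : L}

theorem IsSeparatingParameter.zpow_ne_one (hA : IsSeparatingParameter p σ α η) {k : ℤ}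
    (hk : k ≠ 0) (hk' : k.natAbs < 10) : σ ^ k ≠ 1 := fun h =>
  hA.pow_ne_one (Int.natAbs_ne_zero.2 hk) hk' (pow_natAbs_eq_one.2 h)

variable [Finite L]

theorem card_eq_card_fixed_pow (s : RingAut L) :
    Nat.card L = Nat.card {x // s x = x} ^ orderOf s := by
  have := Fintype.ofFinite (Subgroup.zpowers s)
  have hfixed : Nat.card (FixedPoints.subfield (Subgroup.zpowers s) L) =
      Nat.card {x // s x = x} := Nat.card_congr <| Equiv.subtypeEquivRight fun x =>
    ⟨fun h => h ⟨s, Subgroup.mem_zpowers s⟩, fun h k =>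
      (Subgroup.zpowers_le (H := MulAction.stabilizer (RingAut L) x)).2 h k.2⟩
  rw [← hfixed, ← Nat.card_zpowers, Nat.card_eq_fintype_card (α := Subgroup.zpowers s),
    ← FixedPoints.finrank_eq_card (Subgroup.zpowers s) L]
  exact Module.natCard_eq_pow_finrank

variable [Fact p.Prime] [Algebra (ZMod p) L]

theorem le_card_fixed (p : ℕ) [Fact p.Prime] [Algebra (ZMod p) L] (s : RingAut L) :
    p ≤ Nat.card {x // s x = x} := by
  have hfix : ∀ k : ZMod p, s (algebraMap (ZMod p) L k) = algebraMap (ZMod p) L k :=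
    DFunLike.congr_fun (RingHom.ext_zmod ((s : L →+* L).comp (algebraMap (ZMod p) L)) _)
  simpa using Nat.card_le_card_of_injective
    (fun k : ZMod p => (⟨algebraMap (ZMod p) L k, hfix k⟩ : {x // s x = x})) fun k k' h =>
      (algebraMap (ZMod p) L).injective (congrArg Subtype.val h)

theorem IsSeparatingParameter.pow_two_lt_card (hA : IsSeparatingParameter p σ α η) :
    p ^ 2 < Nat.card L := by
  have hp := (Fact.out : p.Prime)
  calc p ^ 2 < p ^ orderOf σ :=
        Nat.pow_lt_pow_right hp.one_lt (by linarith [hA.lt_orderOf])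
    _ ≤ Nat.card {x // σ x = x} ^ orderOf σ := Nat.pow_le_pow_left (le_card_fixed p σ) _
    _ = Nat.card L := (card_eq_card_fixed_pow σ).symm

variable {W : Type*} [AddCommGroup W] {f : W → W → W}

theorem not_equivalent_of_sq_card_le (hA : IsSeparatingParameter p σ α η) {H : Type*}
    (hH : Nat.card L * Nat.card L ≤ Nat.card H) {X Y Z : H → W →+ W}
    (h : ∀ i, IsDerivation f (X i) (Y i) (Z i)) (hinj : Function.Injective fun i => (X i, Y i)) :
    ¬ Equivalent p (newMul σ (σ ^ 3) α η) f := fun hE =>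
  hA.pow_two_lt_card.not_ge (Nat.le_of_mul_le_mul_right
    (hH.trans (card_le_of_isDerivation hA hE h hinj)) Nat.card_pos)

theorem not_equivalent_of_card_le_card_nucleus (hA : IsSeparatingParameter p σ α η)
    (hf : IsSemifield f) (hnucleus : Nat.card L ≤ Nat.card (leftNucleus f) ∨
      Nat.card L ≤ Nat.card (middleNucleus f) ∨ Nat.card L ≤ Nat.card (rightNucleus f)) :
    ¬ Equivalent p (newMul σ (σ ^ 3) α η) f := by
  intro hE
  have hp := hf.toIsPresemifield
  obtain ⟨e, he⟩ := hf.exists_one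
  have hl : Function.Injective hp.mulLeft := fun x y hxy => by
    rw [← (he x).1, ← (he y).1]
    exact DFunLike.congr_fun hxy e
  have hr : Function.Injective hp.mulRight := fun x y hxy => by
    rw [← (he x).2, ← (he y).2]
    exact DFunLike.congr_fun hxy e
  have hcard := hA.pow_two_lt_card
  rcases hnucleus with h | h | h
  · exact hcard.not_ge (h.trans (card_le_of_isDerivation_left hA hE (H := leftNucleus f)
      (X := fun i => hp.mulLeft i) (Z := fun i => hp.mulLeft i)
      (fun i => hp.isDerivation_left fun x y => (i.2 x y).symm)
      (hl.comp Subtype.val_injective)))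
  · exact hcard.not_ge (h.trans (card_le_of_isDerivation_middle hA hE (H := middleNucleus f)
      (X := fun i => hp.mulRight i) (Y := fun i => -hp.mulLeft i)
      (fun i x y => by
        change 0 = f (f x i) y + f x (-f i y)
        rw [i.2 x y, hp.mul_neg, add_neg_cancel])
      (hr.comp Subtype.val_injective)))
  · exact hcard.not_ge (h.trans (card_le_of_isDerivation_right hA hE (H := rightNucleus f)
      (Y := fun i => hp.mulRight i) (Z := fun i => hp.mulRight i)
      (fun i => hp.isDerivation_right fun x y => i.2 x y)
      (hr.comp Subtype.val_injective)))

theorem not_equivalent_dicksonMul (hA : IsSeparatingParameter p σ α η) (s t r : RingAut L)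
    (a : L) : ¬ Equivalent p (newMul σ (σ ^ 3) α η) (dicksonMul s t r a) := by
  let φ : L × L × L →+ L := AddMonoidHom.mk'
    (fun q => s (r q.1 + t q.2.2 - q.2.1) + q.2.2 - q.1 - q.2.1) fun x y => by
      simp only [Prod.fst_add, Prod.snd_add, map_add, map_sub]; ring
  have hcard : Nat.card L * Nat.card L ≤ Nat.card φ.ker := by
    have hker := card_le_card_ker_mul φ
    rw [Nat.card_prod, Nat.card_prod, ← mul_assoc] at hker
    exact Nat.le_of_mul_le_mul_right hker Nat.card_pos
  refine not_equivalent_of_sq_card_le hA hcard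
    (X := fun q => AddMonoidHom.mulLeft (r q.1.1 + t q.1.2.2 - q.1.2.1, q.1.1))
    (Y := fun q => AddMonoidHom.mulLeft (q.1.2.1, q.1.2.2))
    (Z := fun q => AddMonoidHom.mulLeft (r q.1.1 + t q.1.2.2, q.1.1 + q.1.2.1)) ?_ ?_
  · rintro ⟨⟨b, c, d⟩, hq : s (r b + t d - c) + d - b - c = 0⟩ x y
    rw [map_sub, map_add] at hq
    simp only [dicksonMul, AddMonoidHom.coe_mulLeft, Prod.fst_mul, Prod.snd_mul, Prod.mk_mul_mk,
      map_mul, map_add, map_sub, Prod.mk_add_mk, Prod.mk.injEq]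
    constructor
    · ring
    · linear_combination -s x.1 * y.2 * hq
  · rintro ⟨⟨b, c, d⟩, _⟩ ⟨⟨b', c', d'⟩, _⟩ h
    simp only [Prod.mk.injEq, mulLeft_eq_mulLeft] at h
    simp [h]

theorem not_equivalent_of_isDerivation_mulLeft {f : L × L → L × L → L × L}
    (hA : IsSeparatingParameter p σ α η) {a c u w : L → L → L}
    (h : ∀ b d, IsDerivation f (AddMonoidHom.mulLeft (a b d, b)) (AddMonoidHom.mulLeft (c b d, d))
      (AddMonoidHom.mulLeft (u b d, w b d))) : ¬ Equivalent p (newMul σ (σ ^ 3) α η) f := by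
  refine not_equivalent_of_sq_card_le hA (H := L × L) (by rw [Nat.card_prod])
    (fun q => h q.1 q.2) fun q q' hq => ?_
  simp only [Prod.mk.injEq, mulLeft_eq_mulLeft] at hq
  exact Prod.ext hq.1.2 hq.2.2

theorem not_equivalent_knuthIMul (hA : IsSeparatingParameter p σ α η) (s : RingAut L) (a b : L) :
    ¬ Equivalent p (newMul σ (σ ^ 3) α η) (knuthIMul s a b) := by
  refine not_equivalent_of_isDerivation_mulLeft hA
    (a := fun b d => b + s.symm (s.symm d) - s.symm d) (c := fun b d => s b + s.symm d - b)
    (u := fun b d => s b + s.symm (s.symm d)) (w := fun b d => s b + s.symm d) fun b d x y => ?_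
  simp only [knuthIMul, AddMonoidHom.coe_mulLeft, Prod.fst_mul, Prod.snd_mul, Prod.mk_mul_mk,
    map_mul, map_add, map_sub, RingEquiv.apply_symm_apply, Prod.mk_add_mk, Prod.mk.injEq]
  constructor <;> ring

theorem not_equivalent_knuthIIMul (hA : IsSeparatingParameter p σ α η) (s : RingAut L) (a b : L) :
    ¬ Equivalent p (newMul σ (σ ^ 3) α η) (knuthIIMul s a b) := by
  refine not_equivalent_of_isDerivation_mulLeft hA (a := fun b _ => b)
    (c := fun b d => s b + d - b) (u := fun b d => s b + d) (w := fun b d => s b + d)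
    fun b d x y => ?_
  simp only [knuthIIMul, AddMonoidHom.coe_mulLeft, Prod.fst_mul, Prod.snd_mul, Prod.mk_mul_mk,
    map_mul, Prod.mk_add_mk, Prod.mk.injEq]
  constructor <;> ring

theorem not_equivalent_knuthIIIMul (hA : IsSeparatingParameter p σ α η) (s : RingAut L)
    (a b : L) : ¬ Equivalent p (newMul σ (σ ^ 3) α η) (knuthIIIMul s a b) := by
  refine not_equivalent_of_isDerivation_mulLeft hA
    (a := fun b d => s.symm b + s.symm (s.symm d) - s.symm d) (c := fun _ d => s.symm d)
    (u := fun b d => s.symm b + s.symm (s.symm d)) (w := fun b d => b + s.symm d) fun b d x y => ?_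
  simp only [knuthIIIMul, AddMonoidHom.coe_mulLeft, Prod.fst_mul, Prod.snd_mul, Prod.mk_mul_mk,
    map_mul, map_add, map_sub, RingEquiv.apply_symm_apply, Prod.mk_add_mk, Prod.mk.injEq]
  constructor <;> ring

theorem not_equivalent_knuthIVMul (hA : IsSeparatingParameter p σ α η) (s : RingAut L) (a b : L) :
    ¬ Equivalent p (newMul σ (σ ^ 3) α η) (knuthIVMul s a b) := by
  refine not_equivalent_of_isDerivation_mulLeft hA (a := fun b _ => s.symm b) (c := fun _ d => d)
    (u := fun b d => s.symm b + d) (w := fun b d => b + d) fun b d x y => ?_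
  simp only [knuthIVMul, AddMonoidHom.coe_mulLeft, Prod.fst_mul, Prod.snd_mul, Prod.mk_mul_mk,
    map_mul, RingEquiv.apply_symm_apply, Prod.mk_add_mk, Prod.mk.injEq]
  constructor <;> ring

/-! ## Families with other torus weights or noncentral nuclei -/

theorem not_equivalent_bierbrauerMul (hA : IsSeparatingParameter p σ α η) (s : RingAut L)
    (a b c d h : L) : ¬ Equivalent p (newMul σ (σ ^ 3) α η) (bierbrauerMul s a b c d h) := by
  intro hE
  let scalar := Module.toAddMonoidEnd L (L × L)
  obtain ⟨-, ρ, hρ, hweight⟩ := eq_mul_or_eq_mul_of_isDerivation hA hE (F := scalar)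
    (G := scalar) (μ₁ := 1) (ν₁ := s) (μ₂ := 1) (ν₂ := 1) fun e x y => by
      simp only [scalar, bierbrauerMul, Module.toAddMonoidEnd_apply_apply,
        AddMonoidHom.coe_mulLeft, Prod.smul_fst, Prod.smul_snd, smul_eq_mul, Prod.mk_mul_mk,
        map_mul, RingAut.one_apply, Prod.mk_add_mk, Prod.mk.injEq]
      constructor <;> ring
  rw [or_self, mul_one] at hweight
  rcases hρ with rfl | rfl
  · exact hA.ne_one hweight.symm
  · exact hA.pow_ne_one three_ne_zero (by norm_num) hweight.symm

theorem not_equivalent_taniguchiMul (hA : IsSeparatingParameter p σ α η) (s : RingAut L)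
    (a b h : L) : ¬ Equivalent p (newMul σ (σ ^ 3) α η) (taniguchiMul s a b h) := by
  intro hE
  let torus := (Module.toAddMonoidEnd (L × L) (L × L)).comp
    ((RingHom.id L).prod ((s * s : RingAut L) : L →+* L))
  obtain ⟨⟨ρ, hρ, hs⟩, ρ', hρ', hss⟩ := eq_mul_or_eq_mul_of_isDerivation hA hE (F := torus)
    (G := torus) (μ₁ := s * s) (ν₁ := s * (s * s)) (μ₂ := 1) (ν₂ := s * s) fun e x y => by
      change (_, _) * _ = taniguchiMul s a b h ((e, s (s e)) * x) y +
        taniguchiMul s a b h x ((e, s (s e)) * y)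
      simp only [taniguchiMul, Prod.fst_mul, Prod.snd_mul, Prod.mk_mul_mk, map_mul, map_add,
        map_sub, RingAut.one_apply, RingAut.mul_apply, Prod.mk_add_mk, Prod.mk.injEq]
      constructor <;> ring
  have exists_zpow : ∀ {ρ : RingAut L}, (ρ = σ ∨ ρ = σ ^ 3) →
      ∃ i : ℤ, (i = 1 ∨ i = 3) ∧ ρ = σ ^ i := by
    rintro ρ (rfl | rfl)
    exacts [⟨1, .inl rfl, (zpow_one _).symm⟩, ⟨3, .inr rfl, rfl⟩]
  obtain ⟨i, hi, rfl⟩ := exists_zpow hρ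
  obtain ⟨j, hj, rfl⟩ := exists_zpow hρ'
  have hs' : s = σ ^ i ∨ s = σ ^ (-i) := by
    rw [mul_left_inj, ← mul_assoc (σ ^ i), right_eq_mul] at hs
    exact hs.imp_right fun h => by rw [zpow_neg, eq_inv_of_mul_eq_one_right h]
  have hss' : s * s = σ ^ j ∨ s * s = σ ^ (-j) := by
    rw [mul_one] at hss
    exact hss.imp_right fun h => by rw [zpow_neg, eq_inv_of_mul_eq_one_right h.symm]
  rcases hs' with rfl | rfl <;> rcases hss' with h | h <;>
    rw [← zpow_add, ← mul_inv_eq_one, ← zpow_neg, ← zpow_add] at h <;>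
    exact hA.zpow_ne_one (by omega) (by omega) h

theorem card_fixed_le_of_dempwolffMul (hA : IsSeparatingParameter p σ α η) {s t : RingAut L}
    {a h : L} (hf : IsPresemifield (dempwolffMul s t a h))
    (hE : Equivalent p (newMul σ (σ ^ 3) α η) (dempwolffMul s t a h)) :
    Nat.card {x // s x = x} ≤ p ^ 2 := by
  refine card_le_of_isDerivation_right hA hE (Y := fun k => AddMonoidHom.mulLeft (k.1, k.1))
    (Z := fun k => AddMonoidHom.mulLeft (k.1, k.1))
    (fun k => hf.isDerivation_right fun x y => ?_) fun k k' hk => ?_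
  · have hk : s.symm k = k := (RingEquiv.symm_apply_eq s).2 k.2.symm
    simp only [dempwolffMul, AddMonoidHom.coe_mulLeft, Prod.fst_mul, Prod.snd_mul,
      Prod.mk_mul_mk, map_mul, k.2, hk, Prod.mk.injEq]
    constructor <;> ring
  · exact Subtype.ext (congrArg Prod.fst (mulLeft_eq_mulLeft.1 hk))

theorem not_forall_dempwolffMul_eq {s : RingAut L} (hs : s ≠ 1) (t : RingAut L) (a h : L)
    (c : L × L) : ¬ ∀ y, dempwolffMul s t a h c y = (y.2, a * y.1) := by
  classical
  intro hc
  have := Fintype.ofFinite (RingAut L)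
  have hunique := (IsAutExpansion.ringAut (1 : RingAut L)).unique
    (c' := fun g => c.2 * (Pi.single s 1 : RingAut L → L) g -
      h * t c.2 * (Pi.single s⁻¹ 1 : RingAut L → L) g) fun z => by
    rw [← ((IsAutExpansion.ringAut s).const_mul c.2).sub
      ((IsAutExpansion.ringAut s⁻¹).const_mul (h * t c.2)) z]
    simpa [dempwolffMul] using congrArg Prod.fst (hc (0, z)).symm
  simpa [Pi.single_apply, hs, hs.symm, eq_comm (a := (1 : RingAut L))] using congrFun hunique 1

theorem not_equivalent_dempwolffMul (hA : IsSeparatingParameter p σ α η) {s t : RingAut L}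
    {a h : L} (ha : s a = a) (hf : IsPresemifield (dempwolffMul s t a h)) :
    ¬ Equivalent p (newMul σ (σ ^ 3) α η) (dempwolffMul s t a h) := by
  intro hE
  have hs : s ≠ 1 := by
    rintro rfl
    refine hA.pow_two_lt_card.not_ge (le_of_eq_of_le ?_ (card_fixed_le_of_dempwolffMul hA hf hE))
    exact (Nat.card_congr (Equiv.subtypeUnivEquiv fun _ => rfl)).symm
  have ha' : s.symm a = a := (RingEquiv.symm_apply_eq s).2 ha.symm
  let N : L × L →+ L × L := AddMonoidHom.mk' (fun y => (y.2, a * y.1)) fun x y => by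
    simp [mul_add]
  have hN : ∀ y, N y = (y.2, a * y.1) := fun _ => rfl
  obtain ⟨X, hX⟩ := exists_middle_of_right hA hE (Y := N) (Z := N) <|
    hf.isDerivation_right fun x y => by
      simp only [dempwolffMul, hN, map_mul, ha, ha', Prod.mk.injEq]
      constructor <;> ring
  refine not_forall_dempwolffMul_eq hs t a h (-X (1, 0)) fun y => ?_
  rw [hf.neg_mul, ← hN, eq_comm, ← add_eq_zero_iff_eq_neg']
  simpa [dempwolffMul] using (hX (1, 0) y).symm

end Families

/-! ## Irreducible semilinear maps -/

theorem exists_fixedNorm_eq {K : Type*} [Field K] [Finite K] {s : RingAut K} {c : K}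
    (hc : s c = c) : ∃ u, fixedNorm s u = c := by
  let F := FixedPoints.subfield (Subgroup.zpowers s) K
  have := Fintype.ofFinite (Subgroup.zpowers s)
  have hcF : c ∈ F := fun g =>
    (Subgroup.zpowers_le (H := MulAction.stabilizer (RingAut K) c)).2 hc g.2
  obtain ⟨u, hu⟩ := FiniteField.norm_surjective F K ⟨c, hcF⟩
  refine ⟨u, ?_⟩
  calc fixedNorm s u = ∏ g : Subgroup.zpowers s, g.1 u := by
        rw [fixedNorm, prod_range]
        exact Fintype.prod_equiv (finEquivZPowers (isOfFinOrder_of_finite s)) _ _ fun _ => rfl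
    _ = ∏ g : Gal(K/F), g u := Fintype.prod_equiv
        (FixedPoints.toAlgAutMulEquiv (Subgroup.zpowers s) K).toEquiv _ _ fun _ => rfl
    _ = algebraMap F K (Algebra.norm F u) := (Algebra.norm_eq_prod_automorphisms F u).symm
    _ = c := by rw [hu]; rfl

section Semilinear

variable {k K V : Type*} [Field k] [Field K] [AddCommGroup V] [Module k V] [Module K V]
  {s : RingAut K} {T : Module.End k V}

theorem pow_apply_smul (hT : ∀ (c : K) v, T (c • v) = s c • T v) (i : ℕ) (c : K) (v : V) :
    (T ^ i) (c • v) = (s ^ i) c • (T ^ i) v := by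
  induction i with
  | zero => rfl
  | succ i ih => rw [pow_succ', Module.End.mul_apply, ih, hT, pow_succ', RingAut.mul_apply,
      Module.End.mul_apply]

theorem exists_ne_zero_apply_eq_self [Finite K] [Nontrivial V]
    (hT : ∀ (c : K) v, T (c • v) = s c • T v) (hpow : T ^ orderOf s = 1) :
    ∃ w, w ≠ 0 ∧ T w = w := by
  obtain ⟨v, hv⟩ := exists_ne (0 : V)
  let trace := ∑ i ∈ range (orderOf s), T ^ i
  obtain ⟨c, hc⟩ : ∃ c : K, trace (c • v) ≠ 0 := by
    by_contra! h
    refine hv (congrFun (eq_zero_of_sum_ringAut_smul (g := fun i : Fin (orderOf s) => s ^ (i : ℕ))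
      (v := fun i => (T ^ (i : ℕ)) v) (fun i j hij => Fin.ext (pow_injOn_Iio_orderOf i.2 j.2 hij))
      fun c => ?_) ⟨0, orderOf_pos s⟩)
    rw [← h c, LinearMap.sum_apply, sum_range]
    exact sum_congr rfl fun i _ => (pow_apply_smul hT i c v).symm
  refine ⟨trace (c • v), hc, sub_eq_zero.1 ?_⟩
  change ((T - 1) * trace) (c • v) = 0
  rw [mul_geom_sum, hpow, sub_self, LinearMap.zero_apply]

/-- A bijective semilinear map without proper invariant subspaces. It is encoded as a linear map
over a field `k` of scalars on which the automorphism `s` is trivial. -/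
structure IsIrreducibleSemilinear (s : RingAut K) (T : Module.End k V) : Prop where
  map_smul : ∀ (c : K) v, T (c • v) = s c • T v
  injective : Function.Injective T
  eq_bot_or_eq_top : ∀ U : Submodule K V, (∀ v ∈ U, T v ∈ U) → U = ⊥ ∨ U = ⊤

namespace IsIrreducibleSemilinear

theorem finrank_le_of_pow_apply_mem_span (hT : IsIrreducibleSemilinear s T) {m : ℕ} {v : V}
    (hv : v ≠ 0) (h : (T ^ m) v ∈ Submodule.span K (Set.range fun i : Fin m => (T ^ (i : ℕ)) v)) :
    Module.finrank K V ≤ m := by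
  set U := Submodule.span K (Set.range fun i : Fin m => (T ^ (i : ℕ)) v) with hspan
  have hmem : ∀ i ≤ m, (T ^ i) v ∈ U := fun i hi =>
    hi.lt_or_eq.elim (fun hi => Submodule.subset_span ⟨⟨i, hi⟩, rfl⟩) fun hi => hi ▸ h
  have hinv : ∀ u ∈ U, T u ∈ U := fun u hu => by
    induction hu using Submodule.span_induction with
    | mem x hx =>
      obtain ⟨i, rfl⟩ := hx
      simpa only [pow_succ', Module.End.mul_apply] using hmem (i + 1) i.2
    | zero => rw [map_zero]; exact U.zero_mem
    | add x y _ _ hx hy => rw [map_add]; exact U.add_mem hx hy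
    | smul c x _ hx => rw [hT.map_smul]; exact U.smul_mem _ hx
  rcases hT.eq_bot_or_eq_top U hinv with hU | hU
  · exact absurd ((Submodule.mem_bot K).1 (hU ▸ hmem 0 m.zero_le)) hv
  · have hrank := finrank_range_le_card (R := K) fun i : Fin m => (T ^ (i : ℕ)) v
    rwa [Set.finrank, ← hspan, hU, finrank_top, Fintype.card_fin] at hrank

theorem finrank_le_one_of_apply_eq_smul (hT : IsIrreducibleSemilinear s T) {w : V} (hw : w ≠ 0)
    {u : K} (h : T w = u • w) : Module.finrank K V ≤ 1 := by
  refine hT.finrank_le_of_pow_apply_mem_span hw ?_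
  rw [pow_one, h]
  exact Submodule.smul_mem _ _ (Submodule.subset_span ⟨0, rfl⟩)

end IsIrreducibleSemilinear

variable [Algebra k K] [IsScalarTower k K V]

theorem smul_pow_apply (hT : ∀ (c : K) v, T (c • v) = s c • T v) (u : K) (i : ℕ) (v : V) :
    ((u • T) ^ i) v = (∏ j ∈ range i, (s ^ j) u) • (T ^ i) v := by
  induction i with
  | zero => simp
  | succ i ih =>
    rw [pow_succ', Module.End.mul_apply, ih, LinearMap.smul_apply, hT, smul_smul,
      prod_range_succ', map_prod, pow_zero, RingAut.one_apply, mul_comm, pow_succ',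
      Module.End.mul_apply]
    simp only [pow_succ', RingAut.mul_apply]

/-- The algebra of `K`-linear endomorphisms commuting with `T`. -/
def commutant (K : Type*) [Field K] [Algebra k K] [Module K V] [IsScalarTower k K V]
    (T : Module.End k V) : Subalgebra k (Module.End k V) :=
  Subalgebra.centralizer k (insert T (Set.range (Algebra.lsmul k k V : K → Module.End k V)))

theorem mem_commutant {e : Module.End k V} :
    e ∈ commutant K T ↔ (∀ v, e (T v) = T (e v)) ∧ ∀ (c : K) v, e (c • v) = c • e v := by
  simp only [commutant, Subalgebra.mem_centralizer_iff, Set.forall_mem_insert,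
    Set.forall_mem_range, LinearMap.ext_iff, Module.End.mul_apply, Algebra.lsmul_coe, eq_comm]

theorem pow_apply_of_mem_commutant {e : Module.End k V} (he : e ∈ commutant K T) (i : ℕ) (v : V) :
    e ((T ^ i) v) = (T ^ i) (e v) :=
  DFunLike.congr_fun
    (Commute.pow_right (LinearMap.ext (mem_commutant.1 he).1 : Commute e T) i).eq v

namespace IsIrreducibleSemilinear

theorem pow_orderOf_mem_commutant (hT : IsIrreducibleSemilinear s T) :
    T ^ orderOf s ∈ commutant K T :=
  mem_commutant.2 ⟨DFunLike.congr_fun (pow_mul_comm' T _), fun c v => by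
    rw [pow_apply_smul hT.map_smul, pow_orderOf_eq_one, RingAut.one_apply]⟩

theorem finrank_le_mul_finrank_commutant [Finite K] [Nontrivial V]
    [Module.Finite k (commutant K T)]
    (hT : IsIrreducibleSemilinear s T) :
    Module.finrank K V ≤ orderOf s * Module.finrank k (commutant K T) := by
  obtain ⟨v, hv⟩ := exists_ne (0 : V)
  let z : commutant K T := ⟨T ^ orderOf s, hT.pow_orderOf_mem_commutant⟩
  let q := minpoly k z
  have hq : q.Monic := minpoly.monic (Algebra.IsIntegral.isIntegral z)
  have hzpow : ∀ i : ℕ, ((z ^ i : commutant K T) : Module.End k V) = T ^ (orderOf s * i) :=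
    fun i => (pow_mul T _ i).symm
  have hroot : T ^ (orderOf s * q.natDegree) +
      ∑ i ∈ range q.natDegree, q.coeff i • T ^ (orderOf s * i) = 0 := by
    have haeval : Polynomial.aeval z q = 0 := minpoly.aeval k z
    rw [congrArg (Polynomial.aeval z) hq.as_sum] at haeval
    simpa [hzpow, ← Algebra.smul_def] using congrArg Subtype.val haeval
  refine (hT.finrank_le_of_pow_apply_mem_span hv ?_).trans
    (Nat.mul_le_mul_left _ (minpoly.natDegree_le z))
  rw [eq_neg_of_add_eq_zero_left hroot, LinearMap.neg_apply, LinearMap.sum_apply]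
  refine Submodule.neg_mem _ (Submodule.sum_mem _ fun i hi => ?_)
  rw [LinearMap.smul_apply, ← algebraMap_smul K]
  exact Submodule.smul_mem _ _ (Submodule.subset_span
    ⟨⟨orderOf s * i, (Nat.mul_lt_mul_left (orderOf_pos s)).2 (mem_range.1 hi)⟩, rfl⟩)

theorem finrank_le_one_of_pow_orderOf_apply_eq_smul [Nontrivial V] [Finite K]
    (hT : IsIrreducibleSemilinear s T) {c : K} (hc : ∀ v, (T ^ orderOf s) v = c • v) :
    Module.finrank K V ≤ 1 := by
  obtain ⟨v, hv⟩ := exists_ne (0 : V)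
  have hc₀ : c ≠ 0 := by
    rintro rfl
    have hinj : Function.Injective (T ^ orderOf s) := by
      rw [Module.End.coe_pow]; exact hT.injective.iterate _
    exact hv (hinj (by rw [hc, zero_smul, map_zero]))
  have hsc : s c = c := by
    refine smul_left_injective K ((map_ne_zero_iff T hT.injective).2 hv) ?_
    change s c • T v = c • T v
    rw [← hT.map_smul, ← hc, ← hc, ← (mem_commutant.1 hT.pow_orderOf_mem_commutant).1]
  obtain ⟨u, hu⟩ := exists_fixedNorm_eq (s := s) (c := c⁻¹) (by rw [map_inv₀, hsc])
  have hu₀ : u ≠ 0 := by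
    rintro rfl
    refine inv_ne_zero hc₀ (hu.symm.trans (prod_eq_zero (mem_range.2 (orderOf_pos s)) ?_))
    exact map_zero _
  obtain ⟨w, hw, hTw⟩ := exists_ne_zero_apply_eq_self (T := u • T) (s := s)
    (fun c v => by rw [LinearMap.smul_apply, hT.map_smul, smul_comm, LinearMap.smul_apply])
    (LinearMap.ext fun v => by
      rw [smul_pow_apply hT.map_smul, ← fixedNorm, hu, hc, inv_smul_smul₀ hc₀,
        Module.End.one_apply])
  refine hT.finrank_le_one_of_apply_eq_smul hw (u := u⁻¹) ?_
  rw [eq_inv_smul_iff₀ hu₀, ← LinearMap.smul_apply, hTw]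

theorem finrank_le_one_of_pow_succ_eq_sum [Nontrivial V] [Finite K]
    (hT : IsIrreducibleSemilinear s T) {m : ℕ} (hm : 1 < m) (hms : m ≤ orderOf s) {a : Fin m → K}
    (h : ∀ v, (T ^ (orderOf s + 1)) v = ∑ i, a i • (T ^ (i : ℕ)) v) : Module.finrank K V ≤ 1 := by
  have hcoeff : ∀ v, (T ^ (orderOf s + 1)) v = a ⟨1, hm⟩ • T v := fun v => by
    have hzero := eq_zero_of_sum_ringAut_smul (K := K) (g := fun i : Fin m => s ^ (i : ℕ))
      (v := fun i => a i • (T ^ (i : ℕ)) v -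
        (Pi.single ⟨1, hm⟩ ((T ^ (orderOf s + 1)) v) : Fin m → V) i)
      (fun i j hij => Fin.ext (pow_injOn_Iio_orderOf (i.2.trans_le hms) (j.2.trans_le hms) hij))
      fun c => by
        have hcv := h (c • v)
        simp only [pow_apply_smul hT.map_smul, pow_succ s, pow_orderOf_eq_one, one_mul] at hcv
        simp only [smul_sub, sum_sub_distrib, Pi.single_apply, smul_ite, smul_zero, sum_ite_eq',
          mem_univ, if_true, pow_one, hcv, smul_comm (a _), sub_self]
    have hone := congrFun hzero ⟨1, hm⟩
    rw [Pi.single_eq_same, pow_one] at hone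
    exact (sub_eq_zero.1 hone).symm
  refine hT.finrank_le_one_of_pow_orderOf_apply_eq_smul (c := s.symm (a ⟨1, hm⟩)) fun v =>
    hT.injective ?_
  rw [hT.map_smul, RingEquiv.apply_symm_apply, ← hcoeff, pow_succ', Module.End.mul_apply]

end IsIrreducibleSemilinear

end Semilinear

theorem le_mul_orderOf_of_card_eq_pow {q j n : ℕ} (hq : 1 < q) {K : Type*} [Field K] [Finite K]
    {s : RingAut K} (hK : Nat.card K = q ^ n) (hcard : Nat.card {x // s x = x} ≤ q ^ j) :
    n ≤ j * orderOf s := by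
  rw [← Nat.pow_le_pow_iff_right hq, ← hK, card_eq_card_fixed_pow s, pow_mul]
  exact Nat.pow_le_pow_left hcard _

section Commutant

variable {p : ℕ} [Fact p.Prime] {K V : Type*} [Field K] [Algebra (ZMod p) K]
  [AddCommGroup V] [Nontrivial V] [Finite V] [Module (ZMod p) V] [Module K V]
  [IsScalarTower (ZMod p) K V] {s : RingAut K} {T : Module.End (ZMod p) V}

theorem card_fixed_le_card_commutant (hT : ∀ (c : K) v, T (c • v) = s c • T v) :
    Nat.card {x // s x = x} ≤ Nat.card (commutant K T) := by
  have : Finite (Module.End (ZMod p) V) := Module.finite_of_finite (ZMod p)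
  obtain ⟨v, hv⟩ := exists_ne (0 : V)
  refine Nat.card_le_card_of_injective (fun c => (⟨Algebra.lsmul (ZMod p) (ZMod p) V c.1,
    mem_commutant.2 ⟨fun v => ?_, fun b v => smul_comm _ _ _⟩⟩ : commutant K T)) fun c c' h =>
      Subtype.ext (smul_left_injective K hv (DFunLike.congr_fun (congrArg Subtype.val h) v))
  change c.1 • T v = T (c.1 • v)
  rw [hT, c.2]

variable [Finite K]

theorem IsIrreducibleSemilinear.finrank_le_two_mul_orderOf (hT : IsIrreducibleSemilinear s T)
    (hcard : Nat.card (commutant K T) ≤ p ^ 2) : Module.finrank K V ≤ 2 * orderOf s := by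
  have : Finite (Module.End (ZMod p) V) := Module.finite_of_finite (ZMod p)
  rw [Module.natCard_eq_pow_finrank (K := ZMod p), Nat.card_zmod,
    Nat.pow_le_pow_iff_right (Fact.out : p.Prime).one_lt] at hcard
  rw [mul_comm]
  exact hT.finrank_le_mul_finrank_commutant.trans (Nat.mul_le_mul_left _ hcard)

theorem orderOf_le_of_card_eq_pow {n : ℕ} (hK : Nat.card K = p ^ n) : orderOf s ≤ n := by
  rw [← Nat.pow_le_pow_iff_right (Fact.out : p.Prime).one_lt, ← hK, card_eq_card_fixed_pow s]
  exact Nat.pow_le_pow_left (le_card_fixed p s) _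

end Commutant

section SemilinEnd

variable {K : Type*} [Field K] {d : ℕ} {s : RingAut K} {M : Matrix (Fin d) (Fin d) K}

theorem semilinInv_semilin (hM : IsUnit M.det) (v : Fin d → K) :
    semilinInv s M (semilin s M v) = v := by
  funext i
  simp only [semilinInv, semilin, Matrix.mulVec_mulVec, Matrix.nonsing_inv_mul M hM,
    Matrix.one_mulVec, RingEquiv.symm_apply_apply]

/-- `semilin s M` as a linear map over the prime field. -/
def semilinEnd (p : ℕ) [Algebra (ZMod p) K] (s : RingAut K) (M : Matrix (Fin d) (Fin d) K) :
    Module.End (ZMod p) (Fin d → K) :=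
  (AddMonoidHom.mk' (semilin s M) fun x y => by
    simp only [semilin, Pi.add_apply, map_add]
    exact Matrix.mulVec_add M _ _).toZModLinearMap p

variable {p : ℕ} [Algebra (ZMod p) K]

theorem twistedCyclicMul_apply (hd : 0 < d) (r : RingAut K) (h : K) (x y : Fin d → K) :
    twistedCyclicMul hd s r M h x y = ∑ i : Fin d, y i • (semilinEnd p s M ^ (i : ℕ)) x +
      (h * r (y ⟨0, hd⟩)) • (semilinEnd p s M ^ d) x := by
  simp only [Module.End.pow_apply]
  rfl

theorem dempwolffFormMul_semilinEnd {M : Matrix (Fin 2) (Fin 2) K} (hM : IsUnit M.det)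
    (t : RingAut K) (h : K) (x y : Fin 2 → K) :
    dempwolffFormMul s t M h x (semilinEnd p s M y) = x 0 • semilinEnd p s M y +
      x 1 • semilinEnd p s M (semilinEnd p s M y) + (h * t (x 1)) • y :=
  congrArg (_ + _ • ·) (semilinInv_semilin hM y)

theorem isIrreducibleSemilinear_semilinEnd [Fact p.Prime] (hM : IsIrreducibleSemilin s M) :
    IsIrreducibleSemilinear s (semilinEnd p s M) where
  map_smul c v := by
    change semilin s M (c • v) = s c • semilin s M v
    simp only [semilin, Pi.smul_apply, smul_eq_mul, map_mul]
    exact Matrix.mulVec_smul M (s c) fun i => s (v i)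
  injective := Function.LeftInverse.injective (semilinInv_semilin hM.1)
  eq_bot_or_eq_top := hM.2

end SemilinEnd

section Families

variable {p : ℕ} [Fact p.Prime] {L : Type*} [Field L] [Algebra (ZMod p) L] [Finite L]
  {σ : RingAut L} {α η : L}

theorem not_equivalent_of_isDerivation_smul (hA : IsSeparatingParameter p σ α η) {F W : Type*}
    [Field F] [Finite F] [AddCommGroup W] [Module F W] [Nontrivial W] {f : W → W → W}
    (hF : Nat.card L * Nat.card L ≤ Nat.card F) {s t : RingAut F}
    (h : ∀ a b, s a + t b = a + b → IsDerivation f (Module.toAddMonoidEnd F W a)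
      (Module.toAddMonoidEnd F W b) (Module.toAddMonoidEnd F W (a + b))) :
    ¬ Equivalent p (newMul σ (σ ^ 3) α η) f := by
  let φ : F × F →+ F := AddMonoidHom.mk' (fun q => s q.1 + t q.2 - (q.1 + q.2)) fun x y => by
    simp only [Prod.fst_add, Prod.snd_add, map_add]; ring
  have hcard : Nat.card L * Nat.card L ≤ Nat.card φ.ker := by
    have hker := card_le_card_ker_mul φ
    rw [Nat.card_prod] at hker
    exact hF.trans (Nat.le_of_mul_le_mul_right hker Nat.card_pos)
  obtain ⟨w, hw⟩ := exists_ne (0 : W)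
  have hsmul : Function.Injective (Module.toAddMonoidEnd F W) := fun a b hab =>
    smul_left_injective F hw (DFunLike.congr_fun hab w)
  exact not_equivalent_of_sq_card_le hA hcard (fun q => h q.1.1 q.1.2 (sub_eq_zero.1 q.2))
    fun q q' hq =>
      Subtype.ext (Prod.ext (hsmul (Prod.ext_iff.1 hq).1) (hsmul (Prod.ext_iff.1 hq).2))

theorem not_equivalent_albertMul (hA : IsSeparatingParameter p σ α η) {F : Type*} [Field F]
    [Finite F] (hF : Nat.card L * Nat.card L ≤ Nat.card F) (s t : RingAut F) (c : F) :
    ¬ Equivalent p (newMul σ (σ ^ 3) α η) (albertMul s t c) := by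
  refine not_equivalent_of_isDerivation_smul hA hF (s := s) (t := t) fun a b hab x y => ?_
  simp only [albertMul, Module.toAddMonoidEnd_apply_apply, smul_eq_mul, map_mul]
  linear_combination c * s x * t y * hab

theorem not_equivalent_twistedCyclicMul_one (hA : IsSeparatingParameter p σ α η) {F : Type*}
    [Field F] [Finite F] (hF : Nat.card L * Nat.card L ≤ Nat.card F) (s r : RingAut F)
    (M : Matrix (Fin 1) (Fin 1) F) (h : F) :
    ¬ Equivalent p (newMul σ (σ ^ 3) α η) (twistedCyclicMul one_pos s r M h) := by
  refine not_equivalent_of_isDerivation_smul (F := F) hA hF (s := s) (t := r)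
    fun a b hab x y => funext fun i => ?_
  rw [Subsingleton.elim i 0]
  simp only [twistedCyclicMul, Module.toAddMonoidEnd_apply_apply, Fin.sum_univ_one, semilin,
    Matrix.mulVec, dotProduct, Pi.add_apply, Pi.smul_apply, smul_eq_mul, map_mul,
    Function.iterate_one, Fin.val_zero, Function.iterate_zero, id, Fin.zero_eta]
  linear_combination -h * r (y 0) * M 0 0 * s (x 0) * hab

theorem not_equivalent_dempwolffFormMul (hA : IsSeparatingParameter p σ α η) {n : ℕ} (hn : 6 ≤ n)
    (hL : Nat.card L = p ^ n) {s t : RingAut L} {M : Matrix (Fin 2) (Fin 2) L} {h : L}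
    (hM : IsIrreducibleSemilin s M) (hf : IsPresemifield (dempwolffFormMul s t M h)) :
    ¬ Equivalent p (newMul σ (σ ^ 3) α η) (dempwolffFormMul s t M h) := by
  intro hE
  have hp := (Fact.out : p.Prime).one_lt
  have hT := isIrreducibleSemilinear_semilinEnd (p := p) hM
  have hmul := dempwolffFormMul_semilinEnd (p := p) (s := s) hM.1 t h
  set T := semilinEnd p s M
  have hcomm : ∀ e ∈ commutant L T, IsDerivation (dempwolffFormMul s t M h) 0
      e.toAddMonoidHom e.toAddMonoidHom := fun e he => hf.isDerivation_right fun x y => by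
    obtain ⟨u, rfl⟩ := Finite.surjective_of_injective hT.injective y
    obtain ⟨heT, hesmul⟩ := mem_commutant.1 he
    simp only [LinearMap.toAddMonoidHom_coe, heT, hmul, map_add, hesmul]
  have hcard := card_le_of_isDerivation_right hA hE (H := commutant L T)
    (Y := fun e => e.1.toAddMonoidHom) (fun e => hcomm e.1 e.2)
    (LinearMap.toAddMonoidHom_injective.comp Subtype.val_injective)
  have horder := le_mul_orderOf_of_card_eq_pow hp hL
    ((card_fixed_le_card_commutant hT.map_smul).trans hcard)
  obtain ⟨X, hX⟩ := exists_middle_of_right hA hE (hcomm _ hT.pow_orderOf_mem_commutant)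
  set x := -X ![1, 0] with hx
  have hrank := hT.finrank_le_one_of_pow_succ_eq_sum (m := 3) (by norm_num) (by omega)
    (a := ![h * t (x 1), x 0, x 1]) fun v => by
      have hXv : dempwolffFormMul s t M h ![1, 0] (T ((T ^ orderOf s) v)) =
          dempwolffFormMul s t M h x (T v) := by
        rw [hx, hf.neg_mul, ← Module.End.mul_apply T, ← pow_mul_comm' T]
        exact eq_neg_of_add_eq_zero_right (hX _ _).symm
      rw [hmul, hmul] at hXv
      simpa [pow_succ', Fin.sum_univ_three, add_comm, add_left_comm, add_assoc] using hXv
  rw [Module.finrank_fin_fun] at hrank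
  omega

theorem lt_of_mul_eq_four_mul_prime {d n m l : ℕ} (hl : l.Prime) (hl11 : 11 ≤ l)
    (hdn : d * n = 4 * l) (hn : n ≤ 2 * m) (hm : m ≤ n) (hd : d ≤ 2 * m) : d < m := by
  by_contra! hmd
  have hdvd : l ∣ d * n := ⟨4, by rw [hdn]; ring⟩
  rcases (Nat.Prime.dvd_mul hl).1 hdvd with ⟨k, rfl⟩ | ⟨k, rfl⟩
  · have hkn : k * n = 4 := Nat.eq_of_mul_eq_mul_left hl.pos (by rw [← mul_assoc, hdn]; ring)
    have hn4 : n ≤ 4 := Nat.le_of_dvd (by norm_num) ⟨k, by rw [← hkn, mul_comm]⟩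
    have hk : k ≠ 0 := by rintro rfl; omega
    nlinarith [Nat.pos_of_ne_zero hk]
  · have hdk : d * k = 4 := Nat.eq_of_mul_eq_mul_left hl.pos (by rw [mul_left_comm, hdn]; ring)
    have hd4 : d ≤ 4 := Nat.le_of_dvd (by norm_num) ⟨k, hdk.symm⟩
    have hk : k ≠ 0 := by rintro rfl; omega
    nlinarith [Nat.pos_of_ne_zero hk]

theorem not_equivalent_twistedCyclicMul (hA : IsSeparatingParameter p σ α η) {K : Type*} [Field K]
    [Finite K] [Algebra (ZMod p) K] {d n l : ℕ} (hd : 1 < d) (hK : Nat.card K = p ^ n)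
    (hl : l.Prime) (hl11 : 11 ≤ l) (hdn : d * n = 4 * l) {hd₀ : 0 < d} {s r : RingAut K}
    {M : Matrix (Fin d) (Fin d) K} {h : K} (hM : IsIrreducibleSemilin s M)
    (hf : IsPresemifield (twistedCyclicMul hd₀ s r M h)) :
    ¬ Equivalent p (newMul σ (σ ^ 3) α η) (twistedCyclicMul hd₀ s r M h) := by
  intro hE
  have : Nontrivial (Fin d → K) := ⟨0, 1, fun h0 => zero_ne_one (congrFun h0 ⟨0, hd₀⟩)⟩
  have hp := (Fact.out : p.Prime).one_lt
  have hT := isIrreducibleSemilinear_semilinEnd (p := p) hM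
  have hmul := twistedCyclicMul_apply (p := p) (s := s) (M := M) hd₀ r h
  set T := semilinEnd p s M
  have hcomm : ∀ e ∈ commutant K T, IsDerivation (twistedCyclicMul hd₀ s r M h)
      e.toAddMonoidHom 0 e.toAddMonoidHom := fun e he => hf.isDerivation_left fun x y => by
    simp only [LinearMap.toAddMonoidHom_coe, hmul, map_add, map_sum, (mem_commutant.1 he).2,
      pow_apply_of_mem_commutant he]
  have hcard := card_le_of_isDerivation_left hA hE (H := commutant K T)
    (X := fun e => e.1.toAddMonoidHom) (fun e => hcomm e.1 e.2)
    (LinearMap.toAddMonoidHom_injective.comp Subtype.val_injective)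
  have hrank := hT.finrank_le_two_mul_orderOf hcard
  rw [Module.finrank_fin_fun] at hrank
  have horder : d < orderOf s := lt_of_mul_eq_four_mul_prime hl hl11 hdn
    (le_mul_orderOf_of_card_eq_pow hp hK ((card_fixed_le_card_commutant hT.map_smul).trans hcard))
    (orderOf_le_of_card_eq_pow hK) hrank
  obtain ⟨Y, hY⟩ := exists_middle_of_left hA hE (hcomm _ hT.pow_orderOf_mem_commutant)
  let e₁ : Fin d → K := Pi.single ⟨1, hd⟩ 1
  have hmul_e₁ : ∀ v, twistedCyclicMul hd₀ s r M h v e₁ = T v := fun v => by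
    simp [hmul, e₁, Pi.single_apply]
  set y := -Y e₁ with hy
  have hrank' := hT.finrank_le_one_of_pow_succ_eq_sum (m := d + 1) (by omega) horder
    (a := (Fin.snoc y (h * r (y ⟨0, hd₀⟩)) : Fin (d + 1) → K)) fun v => by
      have hYv : twistedCyclicMul hd₀ s r M h ((T ^ orderOf s) v) e₁ =
          twistedCyclicMul hd₀ s r M h v y := by
        rw [hy, hf.mul_neg]
        exact eq_neg_of_add_eq_zero_left (hY v e₁).symm
      rw [pow_succ', Module.End.mul_apply, ← hmul_e₁, hYv, hmul, Fin.sum_univ_castSucc]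
      simp
  rw [Module.finrank_fin_fun] at hrank'
  omega

end Families

/-! ## Existence of parameters -/

section Field

variable {L : Type*} [Field L] {σ τ : RingAut L} {α η : L}

theorem apply_ne_mul_of_fixedNorm_ne_one (h : fixedNorm σ η ≠ 1) {d : L} (hd : d ≠ 0) :
    σ d ≠ η * d := fun hσ => by
  have hnorm := pow_apply_eq_prod_mul hσ (orderOf σ)
  rw [pow_orderOf_eq_one, RingAut.one_apply] at hnorm
  exact h (mul_right_cancel₀ hd (hnorm.symm.trans (one_mul d).symm))

theorem fixedNorm_eq_pow (h : σ η = η) : fixedNorm σ η = η ^ orderOf σ := by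
  rw [fixedNorm, prod_congr rfl fun i _ => pow_apply_eq_self h i, prod_const, card_range]

theorem fixedNorm_ne_one_of_mul_self_eq_neg_one (h2 : (2 : L) ≠ 0) (hodd : Odd (orderOf σ))
    (hσ : σ η = η) (hη : η * η = -1) : fixedNorm σ η ≠ 1 := by
  rw [fixedNorm_eq_pow hσ]
  intro h
  have hneg : (1 : L) = -1 := by
    rw [← hodd.neg_one_pow, ← hη, mul_pow, h, one_mul]
  exact h2 (by linear_combination hneg)

theorem apply_eq_self_of_mul_self_eq_neg_one (h2 : (2 : L) ≠ 0) (hodd : Odd (orderOf σ))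
    (hη : η * η = -1) : σ η = η := by
  have hsq : σ η * σ η = η * η := by rw [← map_mul, hη, map_neg, map_one]
  refine (mul_self_eq_mul_self_iff.1 hsq).resolve_right fun hneg => ?_
  have hη₀ := eq_zero_of_apply_eq_neg h2 hodd (pow_orderOf_eq_one σ) hneg
  simp [hη₀] at hη

theorem eq_zero_of_newMul_zero_fst_eq_zero (h : fixedNorm σ η ≠ 1) {x₁ : L} {y : L × L}
    (hx₁ : x₁ ≠ 0) (hxy : newMul σ τ α η (0, x₁) y = 0) : y = 0 := by
  obtain ⟨hfst, hsnd⟩ := Prod.mk_eq_zero.1 hxy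
  simp only [map_zero, zero_mul, mul_zero, zero_add, sub_zero, add_zero] at hfst hsnd
  have hy₀ : y.1 = 0 := (map_eq_zero_iff _ τ.injective).1 ((mul_eq_zero.1 hsnd).resolve_left hx₁)
  refine Prod.ext hy₀ (by_contra fun hy₁ => ?_)
  refine apply_ne_mul_of_fixedNorm_ne_one h (div_ne_zero hy₁ hx₁) ?_
  have hσx₁ : σ x₁ ≠ 0 := (map_ne_zero_iff _ σ.injective).2 hx₁
  rw [map_div₀]
  field_simp
  linear_combination hfst

theorem newMul_mul_neg_mul (hστ : ∀ x, σ (τ x) = τ (σ x)) (x₀ x₁ t : L) :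
    newMul σ τ α η (x₀, x₁) (t * x₀, -x₁ * τ t) =
      (α * (σ x₀ * x₀) * (σ t - τ.symm η * t) - σ x₁ * x₁ * τ (σ t - τ.symm η * t), 0) := by
  simp only [newMul, map_mul, map_neg, map_sub, hστ, RingEquiv.apply_symm_apply, Prod.mk.injEq]
  constructor <;> ring

namespace IsNewParameter

theorem eq_zero_of_newMul_eq_zero (h : IsNewParameter σ τ α η) (hστ : ∀ x, σ (τ x) = τ (σ x))
    {x y : L × L} (hx₀ : x.1 ≠ 0) (hxy : newMul σ τ α η x y = 0) : y = 0 := by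
  obtain ⟨x₀, x₁⟩ := x
  obtain ⟨t, y₁, rfl⟩ : ∃ t y₁, y = (t * x₀, y₁) :=
    ⟨y.1 / x₀, y.2, Prod.ext (div_mul_cancel₀ _ hx₀).symm rfl⟩
  obtain rfl : y₁ = -x₁ * τ t := by
    have hsnd : τ x₀ * y₁ + x₁ * τ (t * x₀) = 0 := congrArg Prod.snd hxy
    rw [map_mul] at hsnd
    refine mul_left_cancel₀ ((map_ne_zero_iff _ τ.injective).2 hx₀) ?_
    linear_combination hsnd
  suffices ht : t = 0 by simp [ht]
  by_contra ht
  have hw : σ t - τ.symm η * t ≠ 0 := fun hw => by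
    refine apply_ne_mul_of_fixedNorm_ne_one h.norm_ne ((map_ne_zero_iff _ τ.injective).2 ht) ?_
    rw [hστ, sub_eq_zero.1 hw, map_mul, RingEquiv.apply_symm_apply]
  refine h.alpha_notMem (x₁ / x₀) _ hw ?_
  have hfst := (Prod.mk_eq_zero.1 ((newMul_mul_neg_mul hστ x₀ x₁ t).symm.trans hxy)).1
  rw [map_div₀, div_mul_div_comm, div_mul_div_comm, eq_div_iff (by simp [hx₀, hw])]
  linear_combination hfst

theorem isPresemifield_newMul [Finite L] (h : IsNewParameter σ τ α η) :
    IsPresemifield (newMul σ τ α η) where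
  mul_add x y z := by
    simp only [newMul, Prod.fst_add, Prod.snd_add, map_add, Prod.mk_add_mk, Prod.mk.injEq]
    constructor <;> ring
  add_mul x y z := by
    simp only [newMul, Prod.fst_add, Prod.snd_add, map_add, Prod.mk_add_mk, Prod.mk.injEq]
    constructor <;> ring
  eq_zero_or_eq_zero := by
    rintro ⟨x₀, x₁⟩ y hxy
    refine or_iff_not_imp_left.2 fun hx => ?_
    rcases eq_or_ne x₀ 0 with rfl | hx₀
    · have hx₁ : x₁ ≠ 0 := by
        rintro rfl
        exact hx rfl
      exact eq_zero_of_newMul_zero_fst_eq_zero h.norm_ne hx₁ hxy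
    · exact h.eq_zero_of_newMul_eq_zero
        (fun x => DFunLike.congr_fun (ringAut_mul_comm σ τ) x) hx₀ hxy

end IsNewParameter

variable [Finite L]

theorem isSquare_map_mul_self (g : RingAut L) (b : L) : IsSquare (g b * b) := by
  classical
  have := Fintype.ofFinite L
  by_cases hchar : ringChar L = 2
  · exact FiniteField.isSquare_of_char_two hchar _
  rcases eq_or_ne b 0 with rfl | hb
  · exact ⟨0, by simp⟩
  have hgb : g b ≠ 0 := (map_ne_zero_iff _ g.injective).2 hb
  have hiff : IsSquare (g b) ↔ IsSquare b :=
    ⟨fun h => by simpa using h.map g.symm, fun h => h.map g⟩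
  rw [← quadraticChar_one_iff_isSquare (mul_ne_zero hgb hb), map_mul]
  by_cases h : IsSquare b
  · rw [(quadraticChar_one_iff_isSquare hgb).2 (hiff.2 h),
      (quadraticChar_one_iff_isSquare hb).2 h, one_mul]
  · rw [quadraticChar_neg_one_iff_not_isSquare.2 (hiff.not.2 h),
      quadraticChar_neg_one_iff_not_isSquare.2 h, neg_one_mul, neg_neg]

theorem isSquare_map_div_self (g : RingAut L) (b : L) : IsSquare (g b / b) := by
  rcases eq_or_ne b 0 with rfl | hb
  · exact ⟨0, by simp⟩
  rw [← mul_div_mul_right _ _ hb]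
  exact (isSquare_map_mul_self g b).div (IsSquare.mul_self b)

theorem isSquare_neg_one_of_card_eq_sq {q : ℕ} (hL : Nat.card L = q ^ 2) :
    IsSquare (-1 : L) := by
  have := Fintype.ofFinite L
  rw [FiniteField.isSquare_neg_one_iff, ← Nat.card_eq_fintype_card, hL, Nat.pow_mod]
  have : q % 4 < 4 := Nat.mod_lt _ (by norm_num)
  interval_cases q % 4 <;> norm_num

theorem isNewParameter_cube (hord : 9 < orderOf σ) (hα : ¬ IsSquare α) (hη : fixedNorm σ η ≠ 1) :
    IsNewParameter σ (σ ^ 3) α η where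
  tau_ne h := absurd (Nat.le_of_dvd (by norm_num) (orderOf_dvd_of_pow_eq_one h)) (by omega)
  sigma_sq_ne h := absurd (Nat.le_of_dvd (by norm_num) (orderOf_dvd_of_pow_eq_one h)) (by omega)
  alpha_notMem a b _ h := hα (h ▸ (isSquare_map_mul_self σ a).mul (isSquare_map_div_self _ b))
  norm_ne := hη

theorem isSeparatingParameter_of_mul_self_eq_neg_one {p : ℕ} (h2 : (2 : L) ≠ 0)
    (hord : 9 < orderOf σ) (hodd : Odd (orderOf σ)) (hL : Nat.card L = p ^ (2 * orderOf σ))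
    (hα : α ≠ 0) (hη : η * η = -1) : IsSeparatingParameter p σ α η where
  two_ne := h2
  alpha_ne := hα
  eta_ne := by
    rintro rfl
    simp at hη
  map_eta := apply_eq_self_of_mul_self_eq_neg_one h2 hodd hη
  lt_orderOf := hord
  odd_orderOf := hodd
  card_fixed_le := by
    rw [card_eq_card_fixed_pow σ, pow_mul] at hL
    exact (Nat.pow_left_injective (by omega) hL).le
  map_ne d hd := apply_ne_mul_of_fixedNorm_ne_one (fixedNorm_ne_one_of_mul_self_eq_neg_one h2 hodd
    (apply_eq_self_of_mul_self_eq_neg_one h2 hodd (by simpa using hη)) (by simpa using hη)) hd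

variable {p l : ℕ} [Fact p.Prime] [Algebra (ZMod p) L]

theorem exists_ringAut_orderOf_eq (hl : l.Prime) (h : l ∣ Module.finrank (ZMod p) L) :
    ∃ σ : RingAut L, orderOf σ = l := by
  have : Fact l.Prime := ⟨hl⟩
  refine exists_prime_orderOf_dvd_card' l ?_
  rwa [Nat.card_congr (ringAutEquivGal L p).toEquiv, IsGalois.card_aut_eq_finrank]

theorem exists_isSeparatingParameter (hp : p ≠ 2) (hl : l.Prime) (hl11 : 11 ≤ l)
    (hL : Nat.card L = p ^ (2 * l)) : ∃ (σ : RingAut L) (α η : L),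
      IsSeparatingParameter p σ α η ∧ IsNewParameter σ (σ ^ 3) α η := by
  have := Fintype.ofFinite L
  have : CharP L p := charP_of_injective_algebraMap (algebraMap (ZMod p) L).injective p
  have hchar : ringChar L ≠ 2 := by rwa [ringChar.eq L p]
  have h2 : (2 : L) ≠ 0 := Ring.two_ne_zero hchar
  have hfinrank : Module.finrank (ZMod p) L = 2 * l := by
    have hcard := Module.natCard_eq_pow_finrank (K := ZMod p) (V := L)
    rw [hL, Nat.card_zmod] at hcard
    exact (Nat.pow_right_injective (Fact.out : p.Prime).two_le hcard).symm
  obtain ⟨σ, rfl⟩ := exists_ringAut_orderOf_eq (p := p) (L := L) hl (hfinrank ▸ dvd_mul_left _ 2)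
  obtain ⟨α, hα⟩ := FiniteField.exists_nonsquare hchar
  have hodd : Odd (orderOf σ) := hl.odd_of_ne_two (by omega)
  obtain ⟨η, hη⟩ := isSquare_neg_one_of_card_eq_sq (L := L) (hL.trans (pow_mul' p 2 (orderOf σ)))
  have hA : IsSeparatingParameter p σ α η := isSeparatingParameter_of_mul_self_eq_neg_one h2
    (by omega) hodd hL (by rintro rfl; exact hα (IsSquare.zero)) hη.symm
  exact ⟨σ, α, η, hA, isNewParameter_cube hA.lt_orderOf hα
    (fixedNorm_ne_one_of_mul_self_eq_neg_one h2 hodd hA.map_eta hη.symm)⟩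

end Field

/-! ## Comparison with the known semifields -/

theorem zhouPottMul_comm {L : Type*} [Field L] (σ τ : RingAut L) (α : L) (x y : L × L) :
    zhouPottMul σ τ α x y = zhouPottMul σ τ α y x := by
  have hsymm : ∀ a b : L, σ a * b + a * σ b = σ b * a + b * σ a := fun a b => by ring
  simp only [zhouPottMul, hsymm x.1, hsymm x.2, Prod.mk.injEq, true_and]
  ring

theorem IsKnown.not_equivalent {p l : ℕ} [Fact p.Prime] (hl : l.Prime) (hl11 : 11 ≤ l)
    {σ : RingAut (GaloisField p (2 * l))} {α η : GaloisField p (2 * l)}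
    (hA : IsSeparatingParameter p σ α η) {W : Type} [AddCommGroup W] {f : W → W → W}
    (hf : IsKnown p (2 * l) f) : ¬ Equivalent p (newMul σ (σ ^ 3) α η) f := by
  have hL : Nat.card (GaloisField p (2 * l)) = p ^ (2 * l) := GaloisField.card p _ (by omega)
  have hLL : Nat.card (GaloisField p (2 * l)) * Nat.card (GaloisField p (2 * l)) =
      p ^ (2 * (2 * l)) := by rw [hL, ← pow_add, two_mul (2 * l)]
  cases hf with
  | commutative _ _ _ hcomm => exact fun hE => not_commutative hA hE hcomm
  | largeNucleus _ _ hf hnucleus =>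
    exact not_equivalent_of_card_le_card_nucleus hA hf (by rwa [hL])
  | dickson => exact not_equivalent_dicksonMul hA _ _ _ _
  | knuthI => exact not_equivalent_knuthIMul hA _ _ _
  | knuthII => exact not_equivalent_knuthIIMul hA _ _ _
  | knuthIII => exact not_equivalent_knuthIIIMul hA _ _ _
  | knuthIV => exact not_equivalent_knuthIVMul hA _ _ _
  | bierbrauer => exact not_equivalent_bierbrauerMul hA _ _ _ _ _ _
  | dempwolff _ _ _ _ hfix _ hf => exact not_equivalent_dempwolffMul hA hfix hf
  | dempwolffForm _ _ _ _ hM hf => exact not_equivalent_dempwolffFormMul hA (by omega) hL hM hf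
  | zhouPott => exact fun hE => not_commutative hA hE (zhouPottMul_comm _ _ _)
  | taniguchi => exact not_equivalent_taniguchiMul hA _ _ _ _
  | albert =>
    exact not_equivalent_albertMul hA (by rw [hLL, GaloisField.card p _ (by omega)]) _ _ _
  | twistedCyclic d n hd hdn _ _ _ _ hM hf =>
    have hK : Nat.card (GaloisField p n) = p ^ n :=
      GaloisField.card p n (by rintro rfl; omega)
    rcases Nat.lt_or_ge 1 d with hd₁ | hd₁
    · exact not_equivalent_twistedCyclicMul hA hd₁ hK hl hl11 (by omega) hM hf
    · obtain rfl : d = 1 := by omega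
      exact not_equivalent_twistedCyclicMul_one hA (by rw [hLL, hK, ← hdn, one_mul]) _ _ _ _

end Semifields

theorem mainTheorem7 (p : ℕ) [Fact p.Prime] (hp : p ≠ 2) :
    {m : ℕ | ∃ (σ τ : RingAut (GaloisField p m)) (α η : GaloisField p m),
      Semifields.IsNewParameter σ τ α η ∧ τ η = η ∧
      Semifields.IsPresemifield (Semifields.newMul σ τ α η) ∧
      ∀ (W : Type) [AddCommGroup W] (f : W → W → W), Semifields.IsKnown p m f →
        ¬ Semifields.Equivalent p (Semifields.newMul σ τ α η) f}.Infinite := by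
  refine Set.infinite_of_forall_exists_gt fun a => ?_
  obtain ⟨l, hla, hl⟩ := Nat.exists_infinite_primes (a + 11)
  obtain ⟨σ, α, η, hA, hnew⟩ := Semifields.exists_isSeparatingParameter
    (L := GaloisField p (2 * l)) hp hl (by omega) (GaloisField.card p _ (by omega))
  exact ⟨2 * l, ⟨σ, σ ^ 3, α, η, hnew, Semifields.pow_apply_eq_self hA.map_eta 3,
    hnew.isPresemifield_newMul, fun W _ f hf => hf.not_equivalent hl (by omega) hA⟩, by omega⟩
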